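/- **Conventions.** Let $H_4(x)=-x\log_4\frac{x}{3}-(1-x)\log_4(1-x)$ be the $4$-ary entropy function and let $H_4^{-1}:[0,1]\to[0,3/4]$ be the inverse of its increasing branch. On $\mathbb F_4^n$, $\mathbb F_4=\{0,1,\omega,\bar\omega\}$ with $\omega^2=\omega+1$, $\bar x=x^2$, use the trace inner product $\langle u,v\rangle=\sum_i(u_i\bar v_i+\bar u_iv_i)$. An $[[n,k]]$ (stabilizer) quantum code is given by an additive code $C\subseteq\mathbb F_4^n$ with $C\subseteq C^\perp$ and $|C|=2^{n-k}$; its rate is $k/n$, its minimum distance is the least weight of a vector in $C^\perp\setminus C$, and its relative distance is the minimum distance divided by $n$. A sequence of quantum codes is asymptotically good if the lengths tend to infinity while the rates and the relative distances stay bounded away from $0$. A quantum Reed–Solomon code with parameters $m$ and $k$, where $1\le k\le 2^{m-1}-1$, is the quantum code of length $m(2^m-1)$ with associated additive code $\omega\mathcal B(C_{RS})+\bar\omega\mathcal B(C_{RS})$, where $C_{RS}$ is the cyclic code of length $n_1=2^m-1$ over $\mathbb F_{2^m}$ with generator polynomial $\prod_{i=0}^{n_1-k-1}(x-\alpha^i)$,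 $\alpha$ a primitive element, and $\mathcal B$ is the binary expansion with respect to a self-dual basis of $\mathbb F_{2^m}$ over $\mathbb F_2$. A generalized concatenated quantum code of order $s\ge 2$ is built from $s$ outer quantum Reed–Solomon codes with associated codes $B_1,\dots,B_s$ (same $m$, dimensions $k_1,\dots,k_s$) and $s$ inner $[[n_2,jm]]$ quantum codes, $1\le j\le s$, with nested associated codes $C_s\subseteq\cdots\subseteq C_1$. Choose vectors $g_i,h_i$, $1\le i\le sm$, in $\mathbb F_4^{n_2}$ with $\langle g_i,h_{i'}\rangle=\delta_{ii'}$ and $\langle g_i,g_{i'}\rangle=\langle h_i,h_{i'}\rangle=0$, such that $g_i,h_i\in C_j^\perp$ for $(j-1)m<i\le jm$, and let $\rho:\mathbb F_4^{sm}\to\mathbb F_4^{n_2}$ be the additive map that sends $\omega$ times the $i$-th standard basis vector to $g_i$ and $\bar\omega$ times it to $h_i$. The associated code of the generalized concatenated code, of length $n_1n_2$, consists of all $(\rho(c_1)+u_1,\dots,\rho(c_{n_1})+u_{n_1})$ with $u_l\in C_s$, where $c_1,\dots,c_{n_1}\in(\mathbb F_4^m)^s$ are the columns of an $s\times n_1$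 matrix over $\mathbb F_4^m$ whose $j$-th row is a codeword of $B_j$ for each $j$. **Theorem 4.** Let $0<r<1$, let $s\ge 2$ be an integer, and let $0<\delta<H_4^{-1}\left(\frac{1-r}{2}\right)$. Then there is an asymptotically good sequence of generalized concatenated quantum codes of order $s$, all of relative minimum distance at least $\delta/2$, whose rates converge to $$R=r-\frac rs\sum_{j=1}^{s}\frac{\delta}{H_4^{-1}\left(\frac12\left(1-\frac{rj}{s}\right)\right)}.$$ -/

import Mathlib

open Filter Topology

noncomputable section

namespace GCQ

/-! ### The field with four elements and the trace inner product -/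

/-- The field with four elements. -/
abbrev F4 : Type := GaloisField 2 2

theorem exists_omega : ∃ w : F4, w ^ 2 = w + 1 := by
  classical
  let _ : Fintype F4 := Fintype.ofFinite F4
  have hc : Fintype.card F4 = 4 := by
    rw [← Nat.card_eq_fintype_card]
    simpa using GaloisField.card 2 2 (by norm_num)
  have hlt : ({0, 1} : Finset F4).card < (Finset.univ : Finset F4).card := by
    rw [Finset.card_univ, hc]
    exact lt_of_le_of_lt Finset.card_le_two (by norm_num)
  obtain ⟨x, -, hx⟩ := Finset.exists_mem_notMem_of_card_lt_card hlt
  simp only [Finset.mem_insert, Finset.mem_singleton, not_or] at hx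
  have h4 : x ^ 4 = x := by
    have h := FiniteField.pow_card x
    rwa [hc] at h
  have h2 : (2 : F4) = 0 := CharTwo.two_eq_zero
  have h : x * (x - 1) * (x ^ 2 + x + 1) = 0 := by linear_combination h4
  have h1 : x * (x - 1) ≠ 0 := mul_ne_zero hx.1 (sub_ne_zero.mpr hx.2)
  have h3 : x ^ 2 + x + 1 = 0 := (mul_eq_zero.mp h).resolve_left h1
  exact ⟨x, by linear_combination h3 - (x + 1) * h2⟩

/-- A primitive element `ω` of `F4`, with `ω ^ 2 = ω + 1`. -/
def omega : F4 := exists_omega.choose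

/-- Conjugation `x ↦ x ^ 2` on `F4`. -/
def conj (x : F4) : F4 := x ^ 2

variable {ι : Type} [Fintype ι]

/-- The trace inner product `⟨u, v⟩ = ∑ i, (u i * conj (v i) + conj (u i) * v i)`. -/
def traceInner (u v : ι → F4) : F4 :=
  ∑ i, (u i * conj (v i) + conj (u i) * v i)

/-- The weight of a vector: the number of its nonzero components. -/
def weight (u : ι → F4) : ℕ := Set.ncard {i | u i ≠ 0}

theorem traceInner_add_left (u u' v : ι → F4) :
    traceInner (u + u') v = traceInner u v + traceInner u' v := by
  unfold traceInner conj
  rw [← Finset.sum_add_distrib]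
  refine Finset.sum_congr rfl fun i _ => ?_
  have h2 : (2 : F4) = 0 := CharTwo.two_eq_zero
  simp only [Pi.add_apply]
  linear_combination (u i * u' i * v i) * h2

/-- The trace-dual of an additive code. -/
def traceDual (C : AddSubgroup (ι → F4)) : AddSubgroup (ι → F4) where
  carrier := {u | ∀ v ∈ C, traceInner u v = 0}
  zero_mem' := fun v _ => by simp [traceInner, conj]
  add_mem' := fun {a b} ha hb v hv => by
    rw [traceInner_add_left, ha v hv, hb v hv, add_zero]
  neg_mem' := fun {a} ha v hv => by
    have h := traceInner_add_left (-a) a v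
    rw [ha v hv, neg_add_cancel, add_zero] at h
    rw [← h]
    simp [traceInner, conj]

/-! ### Stabilizer quantum codes -/

/-- A stabilizer quantum code on qubits indexed by `ι`, given by its associated
self-orthogonal additive code over `F4`. -/
structure QuantumCode (ι : Type) [Fintype ι] where
  /-- the associated additive code `C` -/
  code : AddSubgroup (ι → F4)
  /-- `C` is self-orthogonal -/
  selfOrthogonal : code ≤ traceDual code

namespace QuantumCode

/-- The block length (number of physical qubits). -/
def length (_Q : QuantumCode ι) : ℕ := Fintype.card ι

/-- The number `k` of encoded qubits, where `C` has `2 ^ (n - k)` elements. -/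
def encodedQubits (Q : QuantumCode ι) : ℕ := Q.length - Nat.log 2 (Nat.card Q.code)

/-- The minimum distance: the least weight of a vector in `C^⊥ \ C`
(and `0` in case there is no such vector). -/
def minDist (Q : QuantumCode ι) : ℕ :=
  sInf {d | ∃ u ∈ traceDual Q.code, u ∉ Q.code ∧ weight u = d}

/-- The rate `k / n`. -/
def rate (Q : QuantumCode ι) : ℝ := (Q.encodedQubits : ℝ) / (Q.length : ℝ)

/-- The relative minimum distance `d / n`. -/
def relDist (Q : QuantumCode ι) : ℝ := (Q.minDist : ℝ) / (Q.length : ℝ)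

end QuantumCode

/-- A sequence of quantum codes is asymptotically good if the block lengths tend to infinity,
while the rates and the relative minimum distances stay bounded away from zero. -/
def AsymptoticallyGood {J : ℕ → Type} [∀ t, Fintype (J t)] (Q : ∀ t, QuantumCode (J t)) : Prop :=
  Tendsto (fun t => (Q t).length) atTop atTop ∧
    ∃ c : ℝ, 0 < c ∧ ∀ᶠ t in atTop, c ≤ (Q t).rate ∧ c ≤ (Q t).relDist

/-! ### Quantum Reed-Solomon codes -/

/-- The cyclic Reed-Solomon code of length `2 ^ m - 1` and dimension `k` over the field with
`2 ^ m` elements: its generator polynomial is `∏ (X - α ^ i)`, `0 ≤ i < 2 ^ m - 1 - k`, and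
`c` is a codeword if the generator polynomial divides `∑ i, c i * X ^ i`. -/
def rsCode (m k : ℕ) (α : GaloisField 2 m) :
    Submodule (GaloisField 2 m) (Fin (2 ^ m - 1) → GaloisField 2 m) where
  carrier := {c | (∏ i ∈ Finset.range (2 ^ m - 1 - k), (Polynomial.X - Polynomial.C (α ^ i))) ∣
    ∑ i : Fin (2 ^ m - 1), Polynomial.C (c i) * Polynomial.X ^ (i : ℕ)}
  zero_mem' := by simp
  add_mem' := fun {a b} ha hb => by
    simpa [add_mul, Finset.sum_add_distrib] using dvd_add ha hb
  smul_mem' := fun x a ha => by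
    simpa [mul_assoc, Finset.mul_sum] using ha.mul_left (Polynomial.C x)

/-- The binary expansion of a linear code with respect to a basis `b`. -/
def binaryExpansion {m n : ℕ} (b : Module.Basis (Fin m) (ZMod 2) (GaloisField 2 m))
    (C : Submodule (GaloisField 2 m) (Fin n → GaloisField 2 m)) :
    Submodule (ZMod 2) (Fin n × Fin m → ZMod 2) where
  carrier := {c | (fun i => ∑ j, c (i, j) • b j) ∈ C}
  zero_mem' := by
    have e : (fun i => ∑ j, (0 : Fin n × Fin m → ZMod 2) (i, j) • b j) = 0 := by
      funext i
      simp
    rw [Set.mem_ofPred_eq, e]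
    exact C.zero_mem
  add_mem' := fun {x y} hx hy => by
    have e : (fun i => ∑ j, (x + y) (i, j) • b j) =
        (fun i => ∑ j, x (i, j) • b j) + fun i => ∑ j, y (i, j) • b j := by
      funext i
      simp [add_smul, Finset.sum_add_distrib]
    rw [Set.mem_ofPred_eq, e]
    exact C.add_mem hx hy
  smul_mem' := fun a x hx => by
    have e : (fun i => ∑ j, (a • x) (i, j) • b j) =
        algebraMap (ZMod 2) (GaloisField 2 m) a • fun i => ∑ j, x (i, j) • b j := by
      funext i
      simp [Finset.mul_sum, Algebra.smul_def, mul_assoc]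
    rw [Set.mem_ofPred_eq, e]
    exact C.smul_mem _ hx

/-- A basis is self-dual if `Tr (b i * b j) = δ i j`. -/
def IsSelfDualBasis {m : ℕ} (b : Module.Basis (Fin m) (ZMod 2) (GaloisField 2 m)) : Prop :=
  ∀ i j, Algebra.trace (ZMod 2) (GaloisField 2 m) (b i * b j) = if i = j then 1 else 0

/-- The additive code `ω B + conj ω B` over `F4` built from a binary linear code `B`. -/
def omegaCode (B : Submodule (ZMod 2) (ι → ZMod 2)) : AddSubgroup (ι → F4) where
  carrier := {v | ∃ x ∈ B, ∃ y ∈ B, v = fun p =>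
    omega * algebraMap (ZMod 2) F4 (x p) + conj omega * algebraMap (ZMod 2) F4 (y p)}
  zero_mem' := ⟨0, B.zero_mem, 0, B.zero_mem, by funext p; simp⟩
  add_mem' := by
    rintro _ _ ⟨x, hx, y, hy, rfl⟩ ⟨x', hx', y', hy', rfl⟩
    refine ⟨x + x', B.add_mem hx hx', y + y', B.add_mem hy hy', ?_⟩
    funext p
    simp only [Pi.add_apply, map_add]
    ring
  neg_mem' := by
    rintro _ ⟨x, hx, y, hy, rfl⟩
    refine ⟨-x, B.neg_mem hx, -y, B.neg_mem hy, ?_⟩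
    funext p
    simp only [Pi.neg_apply, map_neg]
    ring

/-- `Q` is an `[[m * n, m * (n - 2 * k)]]` quantum Reed-Solomon code, `n = 2 ^ m - 1`,
`1 ≤ k ≤ 2 ^ (m - 1) - 1`: its associated code is obtained from the binary expansion of a
Reed-Solomon code of dimension `k` with respect to a self-dual basis. The index `(l, a)` is
the `a`-th qubit of the `l`-th block. -/
def IsQuantumRS (m k : ℕ) (Q : QuantumCode (Fin (2 ^ m - 1) × Fin m)) : Prop :=
  1 ≤ k ∧ k ≤ 2 ^ (m - 1) - 1 ∧
    ∃ (α : GaloisField 2 m) (b : Module.Basis (Fin m) (ZMod 2) (GaloisField 2 m)),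
      IsPrimitiveRoot α (2 ^ m - 1) ∧ IsSelfDualBasis b ∧
        Q.code = omegaCode (binaryExpansion b (rsCode m k α))

/-! ### Generalized concatenated quantum codes -/

/-- The data for a generalized concatenated quantum code of order `s`, with `s` outer quantum
Reed-Solomon codes of length `n₁ = 2 ^ m - 1` over blocks of `m` qubits and `s` nested inner
codes of length `n₂`. The index `j : Fin s` stands for the number `j + 1` in `{1, …, s}`. -/
structure Concatenation (s m n₂ : ℕ) where
  two_le : 2 ≤ s
  /-- the outer codes, with associated codes `B_j` -/
  outer : Fin s → QuantumCode (Fin (2 ^ m - 1) × Fin m)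
  /-- the dimensions of the underlying Reed-Solomon codes -/
  k : Fin s → ℕ
  outer_rs : ∀ j, IsQuantumRS m (k j) (outer j)
  /-- the inner codes, with associated codes `C_j` -/
  inner : Fin s → QuantumCode (Fin n₂)
  inner_params : ∀ j, (inner j).encodedQubits = ((j : ℕ) + 1) * m
  /-- `C_s ⊆ ⋯ ⊆ C_2 ⊆ C_1` -/
  nested : ∀ i j, i ≤ j → (inner j).code ≤ (inner i).code
  /-- the vectors `g` and `h` of index `(j, a)`, `a : Fin m`, are the `2 * m` vectors of
  the `j`-th part of the symplectic basis; they lie in `C_j^⊥` -/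
  g : Fin s × Fin m → (Fin n₂ → F4)
  h : Fin s × Fin m → (Fin n₂ → F4)
  g_mem : ∀ p, g p ∈ traceDual (inner p.1).code
  h_mem : ∀ p, h p ∈ traceDual (inner p.1).code
  g_g : ∀ p q, traceInner (g p) (g q) = 0
  h_h : ∀ p q, traceInner (h p) (h q) = 0
  g_h : ∀ p q, traceInner (g p) (h q) = if p = q then 1 else 0
  /-- (a choice of representatives for) the inner-product-preserving map from `F4 ^ (s * m)`
  to `C_s^⊥ / C_s`, which carries the standard symplectic basis to the one above -/
  ρ : (Fin s × Fin m → F4) →+ (Fin n₂ → F4)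
  ρ_omega : ∀ p, ρ (Pi.single p omega) = g p
  ρ_conj : ∀ p, ρ (Pi.single p (conj omega)) = h p

namespace Concatenation

variable {s m n₂ : ℕ}

/-- The last inner code, with associated code `C_s`. -/
def lastInner (D : Concatenation s m n₂) : QuantumCode (Fin n₂) :=
  D.inner ⟨s - 1, by have := D.two_le; omega⟩

/-- The additive code of all `(ρ(c_1) + u_1, …, ρ(c_{n₁}) + u_{n₁})`, where `c_l` is the `l`-th
column of the matrix whose rows are codewords of the codes `B_1, …, B_s`, and `u_l ∈ C_s`. -/
def code (D : Concatenation s m n₂) : AddSubgroup (Fin (2 ^ m - 1) × Fin n₂ → F4) where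
  carrier := {v | ∃ b : Fin s → (Fin (2 ^ m - 1) × Fin m → F4), (∀ j, b j ∈ (D.outer j).code) ∧
    ∃ u : Fin (2 ^ m - 1) → (Fin n₂ → F4), (∀ l, u l ∈ D.lastInner.code) ∧
      ∀ l i, v (l, i) = D.ρ (fun p => b p.1 (l, p.2)) i + u l i}
  zero_mem' := by
    refine ⟨0, fun j => (D.outer j).code.zero_mem, 0, fun l => D.lastInner.code.zero_mem,
      fun l i => ?_⟩
    have : (fun p : Fin s × Fin m =>
        (0 : Fin s → (Fin (2 ^ m - 1) × Fin m → F4)) p.1 (l, p.2)) = 0 := rfl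
    rw [this, map_zero]
    simp
  add_mem' := by
    rintro v v' ⟨b, hb, u, hu, hv⟩ ⟨b', hb', u', hu', hv'⟩
    refine ⟨b + b', fun j => (D.outer j).code.add_mem (hb j) (hb' j), u + u',
      fun l => D.lastInner.code.add_mem (hu l) (hu' l), fun l i => ?_⟩
    have : (fun p : Fin s × Fin m => (b + b') p.1 (l, p.2)) =
        (fun p => b p.1 (l, p.2)) + fun p => b' p.1 (l, p.2) := rfl
    rw [this, map_add]
    simp only [Pi.add_apply, hv, hv']
    ring
  neg_mem' := by
    rintro v ⟨b, hb, u, hu, hv⟩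
    refine ⟨-b, fun j => (D.outer j).code.neg_mem (hb j), -u,
      fun l => D.lastInner.code.neg_mem (hu l), fun l i => ?_⟩
    have : (fun p : Fin s × Fin m => (-b) p.1 (l, p.2)) =
        -(fun p => b p.1 (l, p.2)) := rfl
    rw [this, map_neg]
    simp only [Pi.neg_apply, hv]
    ring

end Concatenation

/-- `Q` is a generalized concatenated quantum code of order `s`. -/
def IsGeneralizedConcatenated (s : ℕ) {m n₂ : ℕ}
    (Q : QuantumCode (Fin (2 ^ m - 1) × Fin n₂)) : Prop :=
  ∃ D : Concatenation s m n₂, Q.code = D.code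

/-! ### The entropy function -/

/-- The `q`-ary entropy function. -/
def entropy (q : ℕ) (x : ℝ) : ℝ :=
  -x * Real.logb q (x / ((q : ℝ) - 1)) - (1 - x) * Real.logb q (1 - x)

/-- The inverse of the `q`-ary entropy function on its increasing branch `[0, 1 - 1 / q]`,
which it maps onto `[0, 1]`. -/
def entropyInv (q : ℕ) (y : ℝ) : ℝ :=
  Function.invFunOn (entropy q) (Set.Icc 0 (1 - 1 / (q : ℝ))) y

end GCQ

end

open Filter Topology

noncomputable section

namespace GCQ

/-! Write N = 2^m - 1 and n = ⌈sm/r⌉ for the outer and inner lengths. The construction combines a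
Gilbert–Varshamov choice of all inner codes at once with the dual distance of Reed–Solomon codes.

Inner codes. Let T_j be a set of jm coordinates, increasing in j. Vectors with entries in {0, ω}
that vanish on T_j form nested self-orthogonal codes, and their duals have 2^(n + jm) elements.
Every symplectic map S preserves nesting, duality and the symplectic basis. The symplectic group is
transitive on nonzero vectors, so for each pair of nonzero vectors the maps sending one to the other
form a fraction 1/(4^n - 1) of the group. A union bound (`exists_forall_smul_ne`,
`exists_symplectic_weight_gt`) gives one S for which every j-th dual has minimum weight above p_j n,
as soon as the sum over j of 2^(n + jm) times the volume of the ball of radius p_j n is below 4^n -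
1. With the entropy bound `ncard_weight_le` this holds for large m when H_4(p_j) < (1 - rj/s)/2.

Outer codes. The dual of a k-dimensional Reed–Solomon code has minimum weight above k. A self-dual
basis turns orthogonality over the large field into orthogonality of bits, so `exists_isQuantumRS`
carries this block distance to the quantum code.

Concatenation. A word of the dual of the concatenated code comes from rows b_j in B_j^⊥. If j is the
last nonzero row, more than k_j columns are nonzero, and each gives a nonzero word of C_j^⊥. Hence
the distance is at least min_j k_j p_j n (`IsSplit.exists_mul_le_weight`), and the dimension is m Σ
(N - 2k_j).

Limit. Taking k_j = ⌈δN/(2p_j)⌉ makes the relative distance at least δ/2 and the rate tend to (r/s)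
Σ (1 - δ/p_j). The condition 2k_j < N asymptotically requires δ < p_j. Finally p_j approaches
H_4^{-1}((1 - rj/s)/2) from below, and a diagonal choice of codes gives the stated limit. -/

/-! ### Binary coordinates on the field with four elements -/

theorem omega_sq : omega ^ 2 = omega + 1 := exists_omega.choose_spec

theorem F4.two_eq_zero : (2 : F4) = 0 := CharTwo.two_eq_zero

theorem F4.natCard : Nat.card F4 = 4 := by
  simpa using GaloisField.card 2 2 (by norm_num)

theorem omega_ne_zero : omega ≠ 0 := by
  intro h
  have := omega_sq
  rw [h] at this
  simp at this

theorem F4.pow_four (x : F4) : x ^ 4 = x := by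
  have := Fintype.ofFinite F4
  have h := FiniteField.pow_card x
  rwa [← Nat.card_eq_fintype_card, F4.natCard] at h

theorem conj_omega : conj omega = omega + 1 := omega_sq

/-- The element `a ω + b conj ω` of `F4`. -/
def ofBits (a b : ZMod 2) : F4 :=
  omega * algebraMap (ZMod 2) F4 a + conj omega * algebraMap (ZMod 2) F4 b

theorem ofBits_add (a b c d : ZMod 2) : ofBits (a + c) (b + d) = ofBits a b + ofBits c d := by
  simp only [ofBits, map_add]
  ring

theorem zmod_two_cases (a : ZMod 2) : a = 0 ∨ a = 1 := by
  revert a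
  decide

theorem ofBits_eq_zero {a b : ZMod 2} (h : ofBits a b = 0) : a = 0 ∧ b = 0 := by
  have h2 := F4.two_eq_zero
  have hw := omega_sq
  have hw0 := omega_ne_zero
  rcases zmod_two_cases a with rfl | rfl <;> rcases zmod_two_cases b with rfl | rfl <;>
    simp [ofBits, conj_omega] at h ⊢
  · rw [h] at hw
    exact hw0 (pow_eq_zero_iff two_ne_zero |>.mp hw)
  · exact hw0 h
  · exact one_ne_zero (show (1 : F4) = 0 by linear_combination h - omega * h2)

theorem ofBits_injective : Function.Injective fun p : ZMod 2 × ZMod 2 => ofBits p.1 p.2 := by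
  rintro ⟨a, b⟩ ⟨c, d⟩ h
  have h' : ofBits (a + c) (b + d) = 0 := by
    rw [ofBits_add]
    simp only at h
    rw [h]
    linear_combination ofBits c d * F4.two_eq_zero
  obtain ⟨h1, h2⟩ := ofBits_eq_zero h'
  simp only [Prod.mk.injEq]
  exact ⟨CharTwo.add_eq_zero.mp h1, CharTwo.add_eq_zero.mp h2⟩

theorem ofBits_bijective : Function.Bijective fun p : ZMod 2 × ZMod 2 => ofBits p.1 p.2 := by
  have := Fintype.ofFinite F4
  rw [Fintype.bijective_iff_injective_and_card]
  refine ⟨ofBits_injective, ?_⟩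
  rw [← Nat.card_eq_fintype_card (α := F4), F4.natCard]
  simp

theorem exists_ofBits (x : F4) : ∃ a b, x = ofBits a b := by
  obtain ⟨⟨a, b⟩, h⟩ := ofBits_bijective.2 x
  exact ⟨a, b, h.symm⟩

theorem ofBits_pairing (a b c d : ZMod 2) :
    ofBits a b * conj (ofBits c d) + conj (ofBits a b) * ofBits c d =
      algebraMap (ZMod 2) F4 (a * d + b * c) := by
  have h2 := F4.two_eq_zero
  have hw := omega_sq
  rcases zmod_two_cases a with rfl | rfl <;> rcases zmod_two_cases b with rfl | rfl <;>
  rcases zmod_two_cases c with rfl | rfl <;> rcases zmod_two_cases d with rfl | rfl <;>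
    simp [ofBits, conj] <;> grind

theorem pairing_self (x : F4) : x * conj x + conj x * x = 0 := by
  linear_combination x * conj x * F4.two_eq_zero

/-! ### The trace form and its symplectic group -/

section TraceInner

variable {ι : Type} [Fintype ι]

theorem traceInner_comm (u v : ι → F4) : traceInner u v = traceInner v u := by
  unfold traceInner
  exact Finset.sum_congr rfl fun i _ => by ring

theorem traceInner_add_right (u v v' : ι → F4) :
    traceInner u (v + v') = traceInner u v + traceInner u v' := by
  rw [traceInner_comm, traceInner_add_left, traceInner_comm v, traceInner_comm v']

theorem traceInner_self (u : ι → F4) : traceInner u u = 0 := by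
  unfold traceInner
  exact Finset.sum_eq_zero fun i _ => pairing_self _

theorem traceInner_zero_left (v : ι → F4) : traceInner 0 v = 0 := by
  simp [traceInner, conj]

theorem traceInner_zero_right (v : ι → F4) : traceInner v 0 = 0 := by
  simp [traceInner, conj]

/-- Squaring exchanges the two summands of each term because x^4 = x, so the value is fixed by
Frobenius and lies in the prime field. -/
theorem traceInner_eq_zero_or_one (u v : ι → F4) : traceInner u v = 0 ∨ traceInner u v = 1 := by
  have h : traceInner u v ^ 2 = traceInner u v := by
    unfold traceInner
    rw [sum_pow_char 2]
    refine Finset.sum_congr rfl fun i _ => ?_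
    unfold conj
    linear_combination u i ^ 2 * F4.pow_four (v i) + v i ^ 2 * F4.pow_four (u i) + u i ^3 * v i ^3 * F4.two_eq_zero
  have h' : traceInner u v * (traceInner u v - 1) = 0 := by linear_combination h
  rcases mul_eq_zero.mp h' with h | h
  · exact .inl h
  · exact .inr (sub_eq_zero.mp h)

theorem traceInner_single [DecidableEq ι] (u : ι → F4) (i : ι) (x : F4) :
    traceInner u (Pi.single i x) = u i * conj x + conj (u i) * x := by
  unfold traceInner
  rw [Finset.sum_eq_single i]
  · simp
  · intro j _ hj
    simp [Pi.single_eq_of_ne hj, conj]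
  · simp

theorem exists_traceInner_eq_one {u : ι → F4} (hu : u ≠ 0) : ∃ w, traceInner u w = 1 := by
  classical
  obtain ⟨i, hi⟩ := Function.ne_iff.mp hu
  simp only [Pi.zero_apply] at hi
  -- The pairing becomes u_i^3 (ω^2 + ω), and both factors equal 1.
  refine ⟨Pi.single i (u i * omega), ?_⟩
  rw [traceInner_single]
  have h3 : u i ^ 3 = 1 := by
    have h := F4.pow_four (u i)
    exact mul_left_cancel₀ hi (by linear_combination h)
  unfold conj
  linear_combination (omega ^ 2 + omega) * h3 + omega_sq + omega * F4.two_eq_zero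

theorem eq_zero_of_traceInner {u : ι → F4} (hu : ∀ w, traceInner u w = 0) : u = 0 := by
  by_contra h
  obtain ⟨w, hw⟩ := exists_traceInner_eq_one h
  simp [hu w] at hw

/-- Take a pairing to 1 with u and b pairing to 1 with v. If neither serves both vectors, the cross
pairings vanish and a + b does. -/
theorem exists_traceInner_eq_one_pair {u v : ι → F4} (hu : u ≠ 0) (hv : v ≠ 0) :
    ∃ w, traceInner u w = 1 ∧ traceInner v w = 1 := by
  obtain ⟨a, ha⟩ := exists_traceInner_eq_one hu
  obtain ⟨b, hb⟩ := exists_traceInner_eq_one hv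
  rcases traceInner_eq_zero_or_one v a with h1 | h1
  · rcases traceInner_eq_zero_or_one u b with h2 | h2
    · exact ⟨a + b, by simp [traceInner_add_right, *], by simp [traceInner_add_right, *]⟩
    · exact ⟨b, h2, hb⟩
  · exact ⟨a, ha, h1⟩

variable (ι) in
/-- The group of additive permutations of `ι → F4` preserving the trace inner product. -/
def symplecticGroup : Subgroup (Equiv.Perm (ι → F4)) where
  carrier := {S | (∀ u v, S (u + v) = S u + S v) ∧
    ∀ u v, traceInner (S u) (S v) = traceInner u v}
  mul_mem' := fun {S T} hS hT => by
    refine ⟨fun u v => ?_, fun u v => ?_⟩ <;> simp only [Equiv.Perm.mul_apply]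
    · rw [hT.1, hS.1]
    · rw [hS.2, hT.2]
  one_mem' := ⟨fun u v => rfl, fun u v => rfl⟩
  inv_mem' := fun {S} hS => by
    refine ⟨fun u v => ?_, fun u v => ?_⟩
    · rw [Equiv.Perm.inv_eq_iff_eq, hS.1]
      simp
    · rw [← hS.2]
      simp

theorem vec_add_self {ι : Type} (u : ι → F4) : u + u = 0 := by
  funext i
  simp only [Pi.add_apply, Pi.zero_apply]
  linear_combination u i * F4.two_eq_zero

/-- The symplectic transvection `u ↦ u + ⟨u, w⟩ w`. -/
def transvection (w : ι → F4) : Equiv.Perm (ι → F4) :=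
  have hinv : ∀ u : ι → F4, (u + traceInner u w • w) +
      traceInner (u + traceInner u w • w) w • w = u := fun u => by
    rcases traceInner_eq_zero_or_one u w with h | h
    · simp [h]
    · rw [h, one_smul, traceInner_add_left, h, traceInner_self, add_zero, one_smul, add_assoc,
        vec_add_self, add_zero]
  { toFun := fun u => u + traceInner u w • w
    invFun := fun u => u + traceInner u w • w
    left_inv := hinv
    right_inv := hinv }

theorem transvection_apply (w u : ι → F4) : transvection w u = u + traceInner u w • w := rfl

theorem transvection_mem (w : ι → F4) : transvection w ∈ symplecticGroup ι := by
  refine ⟨fun u v => ?_, fun u v => ?_⟩ <;> simp only [transvection_apply]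
  · rw [traceInner_add_left, add_smul]
    abel
  · rcases traceInner_eq_zero_or_one u w with h | h <;>
    rcases traceInner_eq_zero_or_one v w with h' | h' <;>
    simp only [h, h', zero_smul, one_smul, add_zero, traceInner_add_left, traceInner_add_right,
      traceInner_self, traceInner_comm w v]
    linear_combination F4.two_eq_zero

/-- The transvection along u + v adds u + v to u, since u pairs to 1 with u + v. -/
theorem exists_transvection_of_traceInner {u v : ι → F4} (h : traceInner u v = 1) :
    ∃ S ∈ symplecticGroup ι, S u = v := by
  refine ⟨_, transvection_mem (u + v), ?_⟩
  rw [transvection_apply, traceInner_add_right, h, traceInner_self, zero_add, one_smul,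
    ← add_assoc, vec_add_self, zero_add]

/-- Two transvections suffice, passing through a vector that pairs to 1 with both u and v. -/
theorem symplecticGroup_transitive {u v : ι → F4} (hu : u ≠ 0) (hv : v ≠ 0) :
    ∃ S ∈ symplecticGroup ι, S u = v := by
  obtain ⟨w, h1, h2⟩ := exists_traceInner_eq_one_pair hu hv
  obtain ⟨S, hS, hS'⟩ := exists_transvection_of_traceInner h1
  obtain ⟨T, hT, hT'⟩ := exists_transvection_of_traceInner ((traceInner_comm w v).trans h2)
  exact ⟨T * S, mul_mem hT hS, by rw [Equiv.Perm.mul_apply, hS', hT']⟩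

theorem mem_orbit_symplecticGroup {u v : ι → F4} (hu : u ≠ 0) (hv : v ≠ 0) :
    v ∈ MulAction.orbit (symplecticGroup ι) u := by
  obtain ⟨S, hS, h⟩ := symplecticGroup_transitive hu hv
  exact ⟨⟨S, hS⟩, h⟩

end TraceInner

/-! ### Union bound for a finite group action -/

/-- The elements carrying a to b are either none or a coset of the stabilizer of a, so
orbit–stabilizer applies. -/
theorem natCard_smul_eq_mul_natCard_orbit_le {G X : Type*} [Group G] [Finite G] [MulAction G X]
    (a b : X) : Nat.card {g : G // g • a = b} * Nat.card (MulAction.orbit G a) ≤ Nat.card G := by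
  classical
  have := Fintype.ofFinite G
  have : Fintype (MulAction.orbit G a) := Fintype.ofFinite (Set.range fun g : G => g • a)
  have h := MulAction.card_orbit_mul_card_stabilizer_eq_card_group G a
  simp only [← Nat.card_eq_fintype_card] at h
  rw [← h, mul_comm]
  refine Nat.mul_le_mul_left _ ?_
  by_cases hne : ∃ g₀ : G, g₀ • a = b
  · obtain ⟨g₀, hg₀⟩ := hne
    refine Nat.card_le_card_of_injective
      (fun g : {g : G // g • a = b} => (⟨g₀⁻¹ * g, ?_⟩ : MulAction.stabilizer G a)) ?_
    · rw [MulAction.mem_stabilizer_iff, mul_smul, g.2, ← hg₀, inv_smul_smul]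
    · intro g g' hgg
      simpa [Subtype.ext_iff] using hgg
  · have : IsEmpty {g : G // g • a = b} := ⟨fun g => hne ⟨g.1, g.2⟩⟩
    simp

/-- Each pair in `P` excludes at most the fraction 1/(|P| + 1) of the group, so all the pairs
together cannot exclude every element. -/
theorem exists_forall_smul_ne {G X : Type*} [Group G] [Finite G] [MulAction G X]
    (P : Finset (X × X)) (hP : ∀ p ∈ P, P.card < Nat.card (MulAction.orbit G p.1)) :
    ∃ g : G, ∀ p ∈ P, g • p.1 ≠ p.2 := by
  classical
  have := Fintype.ofFinite G
  by_contra! hcon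
  have hcov : (Finset.univ : Finset G) ⊆ P.biUnion fun p => {g | g • p.1 = p.2} := by
    intro g _
    obtain ⟨p, hp, hg⟩ := hcon g
    simp only [Finset.mem_biUnion, Finset.mem_filter, Finset.mem_univ, true_and]
    exact ⟨p, hp, hg⟩
  have h1 := (Finset.card_le_card hcov).trans Finset.card_biUnion_le
  obtain ⟨p₀, hp₀, -⟩ := hcon 1
  have h2 : ∀ p ∈ P, (Finset.card {g : G | g • p.1 = p.2}) * (P.card + 1) ≤ Fintype.card G := by
    intro p hp
    have h := natCard_smul_eq_mul_natCard_orbit_le (G := G) p.1 p.2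
    rw [Nat.card_eq_fintype_card, Fintype.card_subtype, Nat.card_eq_fintype_card (α := G)] at h
    exact (Nat.mul_le_mul_left _ (hP p hp)).trans h
  have h3 := Finset.sum_le_sum h2
  rw [← Finset.sum_mul, Finset.sum_const, smul_eq_mul] at h3
  have h4 := Nat.mul_le_mul_right (P.card + 1) h1
  rw [Finset.card_univ] at h4
  have h5 := h4.trans h3
  have : 0 < Fintype.card G := Fintype.card_pos
  nlinarith

/-! ### The entropy function and its inverse branch -/

theorem entropy_four_mul_log (x : ℝ) :
    entropy 4 x * Real.log 4 = -x * Real.log (x / 3) - (1 - x) * Real.log (1 - x) := by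
  have h : Real.log 4 ≠ 0 := (Real.log_pos (by norm_num)).ne'
  unfold entropy Real.logb
  norm_num
  field_simp

theorem entropy_four_eq (x : ℝ) : entropy 4 x = Real.qaryEntropy 4 x / Real.log 4 := by
  have h : Real.log 4 ≠ 0 := (Real.log_pos (by norm_num)).ne'
  rw [eq_div_iff h, entropy_four_mul_log]
  unfold Real.qaryEntropy Real.binEntropy
  rw [Real.log_inv, Real.log_inv]
  rcases eq_or_ne x 0 with rfl | hx
  · simp
  · rw [Real.log_div hx (by norm_num)]
    norm_num
    ring

theorem entropy_four_continuous : Continuous (entropy 4) := by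
  have : entropy 4 = fun x => Real.qaryEntropy 4 x / Real.log 4 := funext entropy_four_eq
  rw [this]
  fun_prop

theorem entropy_four_strictMonoOn : StrictMonoOn (entropy 4) (Set.Icc 0 (1 - 1 / ((4 : ℕ) : ℝ))) := by
  intro x hx y hy hxy
  rw [entropy_four_eq, entropy_four_eq]
  exact div_lt_div_of_pos_right (Real.qaryEntropy_strictMonoOn (by norm_num) (by simpa using hx)
    (by simpa using hy) hxy) (Real.log_pos (by norm_num))

theorem entropy_four_zero : entropy 4 0 = 0 := by
  rw [entropy_four_eq]
  simp

theorem entropy_four_three_quarters : entropy 4 (1 - 1 / ((4 : ℕ) : ℝ)) = 1 := by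
  have h : Real.log 4 ≠ 0 := (Real.log_pos (by norm_num)).ne'
  apply mul_right_cancel₀ h
  rw [entropy_four_mul_log]
  norm_num
  have : Real.log (1 / 4) = - Real.log 4 := by rw [one_div, Real.log_inv]
  rw [this]
  ring

theorem entropyInv_four_spec {y : ℝ} (h0 : 0 ≤ y) (h1 : y ≤ 1) :
    entropyInv 4 y ∈ Set.Icc (0 : ℝ) (1 - 1 / ((4 : ℕ) : ℝ)) ∧ entropy 4 (entropyInv 4 y) = y := by
  have hex : ∃ a ∈ Set.Icc (0 : ℝ) (1 - 1 / ((4 : ℕ) : ℝ)), entropy 4 a = y := by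
    have := intermediate_value_Icc (a := (0 : ℝ)) (b := 1 - 1 / ((4 : ℕ) : ℝ)) (by norm_num)
      entropy_four_continuous.continuousOn
    rw [entropy_four_zero, entropy_four_three_quarters] at this
    exact this ⟨h0, h1⟩
  exact Function.invFunOn_pos hex

theorem entropyInv_four_strictMonoOn : StrictMonoOn (entropyInv 4) (Set.Icc 0 1) := by
  intro x hx y hy hxy
  obtain ⟨hx1, hx2⟩ := entropyInv_four_spec hx.1 hx.2
  obtain ⟨hy1, hy2⟩ := entropyInv_four_spec hy.1 hy.2
  rwa [← entropy_four_strictMonoOn.lt_iff_lt hx1 hy1, hx2, hy2]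

theorem entropy_lt_of_lt_entropyInv {p y : ℝ} (h0 : 0 ≤ y) (h1 : y ≤ 1) (hp : 0 ≤ p)
    (h : p < entropyInv 4 y) : entropy 4 p < y := by
  obtain ⟨hy1, hy2⟩ := entropyInv_four_spec h0 h1
  calc entropy 4 p < entropy 4 (entropyInv 4 y) :=
        entropy_four_strictMonoOn ⟨hp, h.le.trans hy1.2⟩ hy1 h
    _ = y := hy2

/-! ### Volume of Hamming balls -/

variable {ι : Type} [Fintype ι]

/-- These are the probabilities of words with independent coordinates, each zero with probability 1
- p and otherwise uniform on the three nonzero symbols. -/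
theorem sum_prod_weight_distribution [DecidableEq ι] [Fintype F4] [DecidableEq F4] (p : ℝ) :
    ∑ u : ι → F4, ∏ i, (if u i = 0 then 1 - p else p / 3) = 1 := by
  have h : ∑ a : F4, (if a = 0 then 1 - p else p / 3) = 1 := by
    rw [← Finset.add_sum_erase _ _ (Finset.mem_univ (0 : F4)),
      Finset.sum_congr rfl (g := fun _ => p / 3) fun a ha => if_neg (Finset.ne_of_mem_erase ha),
      Finset.sum_const, Finset.card_erase_of_mem (Finset.mem_univ _), Finset.card_univ,
      ← Nat.card_eq_fintype_card, F4.natCard]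
    simp
    ring
  classical
  have := Finset.prod_univ_sum (fun _ : ι => (Finset.univ : Finset F4))
    (fun _ a => if a = 0 then 1 - p else p / 3)
  rw [Fintype.piFinset_univ] at this
  rw [← this]
  simp [h]

theorem weight_eq_card [DecidableEq F4] (u : ι → F4) :
    weight u = (Finset.univ.filter fun i => ¬ u i = 0).card := by
  rw [weight, ← Set.ncard_coe_finset]
  simp

/-- At weight exactly pn there is equality. A smaller weight replaces factors p/3 by 1 - p, which is
no smaller because p ≤ 3/4. -/
theorem four_rpow_neg_entropy_le {p : ℝ} (hp0 : 0 < p) (hp1 : p ≤ 3 / 4) {u : ι → F4}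
    [DecidableEq F4] (hu : (weight u : ℝ) ≤ p * Fintype.card ι) :
    (4 : ℝ) ^ (-(Fintype.card ι * entropy 4 p)) ≤ ∏ i, (if u i = 0 then 1 - p else p / 3) := by
  have h1 : (0 : ℝ) < 1 - p := by linarith
  have h3 : (0 : ℝ) < p / 3 := by linarith
  have hcard := Finset.card_filter_add_card_filter_not (s := (Finset.univ : Finset ι))
    (p := fun i => u i = 0)
  rw [← weight_eq_card, Finset.card_univ] at hcard
  have hz : ((Finset.univ.filter fun i => u i = 0).card : ℝ) = Fintype.card ι - weight u := by
    rw [← hcard]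
    push_cast
    ring
  rw [Finset.prod_ite, Finset.prod_const, Finset.prod_const, ← weight_eq_card,
    ← Real.rpow_natCast, ← Real.rpow_natCast, Real.rpow_def_of_pos (by norm_num),
    Real.rpow_def_of_pos h1, Real.rpow_def_of_pos h3, ← Real.exp_add, Real.exp_le_exp, hz]
  have hlog : Real.log (p / 3) ≤ Real.log (1 - p) := Real.log_le_log h3 (by linarith)
  have he := entropy_four_mul_log p
  have : Real.log 4 * -(Fintype.card ι * entropy 4 p) =
      Fintype.card ι * (p * Real.log (p / 3) + (1 - p) * Real.log (1 - p)) := by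
    linear_combination (-(Fintype.card ι : ℝ)) * he
  rw [this]
  nlinarith [mul_nonneg (sub_nonneg.mpr hu) (sub_nonneg.mpr hlog)]

/-- The Hamming ball volume bound in terms of the `4`-ary entropy. -/
theorem ncard_weight_le {p : ℝ} (hp0 : 0 < p) (hp1 : p ≤ 3 / 4) :
    (Set.ncard {u : ι → F4 | (weight u : ℝ) ≤ p * Fintype.card ι} : ℝ) ≤
      (4 : ℝ) ^ (Fintype.card ι * entropy 4 p) := by
  classical
  have := Fintype.ofFinite F4
  set A : Finset (ι → F4) := {u | (weight u : ℝ) ≤ p * Fintype.card ι} with hA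
  have hAc : Set.ncard {u : ι → F4 | (weight u : ℝ) ≤ p * Fintype.card ι} = A.card := by
    rw [← Set.ncard_coe_finset]
    simp [hA]
  rw [hAc]
  have h1 : A.card * (4 : ℝ) ^ (-(Fintype.card ι * entropy 4 p)) ≤ 1 := by
    rw [← sum_prod_weight_distribution (ι := ι) p, ← nsmul_eq_mul]
    refine (Finset.card_nsmul_le_sum A _ _ fun u hu => ?_).trans
      (Finset.sum_le_sum_of_subset_of_nonneg (Finset.subset_univ A) fun u _ _ =>
        Finset.prod_nonneg fun i _ => ?_)
    · exact four_rpow_neg_entropy_le hp0 hp1 (by simpa [hA] using hu)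
    · split_ifs <;> linarith
  rwa [Real.rpow_neg (by norm_num), ← div_eq_mul_inv, div_le_one (by positivity)] at h1

/-! ### Reed–Solomon codes through the discrete Fourier transform -/

section ReedSolomon

variable {m k : ℕ} {α : GaloisField 2 m}

theorem natCast_two_pow_sub_one (hm : m ≠ 0) : ((2 ^ m - 1 : ℕ) : GaloisField 2 m) = 1 := by
  have h2 : (2 : GaloisField 2 m) = 0 := CharTwo.two_eq_zero
  rw [Nat.cast_sub Nat.one_le_two_pow]
  push_cast
  rw [h2, zero_pow hm]
  linear_combination -h2

theorem sum_pow_primitiveRoot (hm : m ≠ 0) (hα : IsPrimitiveRoot α (2 ^ m - 1)) (t : ℕ) :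
    ∑ l : Fin (2 ^ m - 1), α ^ (t * (l : ℕ)) = if 2 ^ m - 1 ∣ t then 1 else 0 := by
  simp only [pow_mul]
  rw [Fin.sum_univ_eq_sum_range fun l => (α ^ t) ^ l]
  split_ifs with h
  · rw [(hα.pow_eq_one_iff_dvd t).mpr h]
    simp [natCast_two_pow_sub_one hm]
  · have h1 : α ^ t ≠ 1 := fun h' => h ((hα.pow_eq_one_iff_dvd t).mp h')
    have h2 := mul_geom_sum (α ^ t) (2 ^ m - 1)
    rw [← pow_mul, mul_comm t, pow_mul, hα.pow_eq_one, one_pow, sub_self] at h2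
    exact (mul_eq_zero.mp h2).resolve_left (sub_ne_zero.mpr h1)

theorem sum_pow_primitiveRoot_eq_zero (hm : m ≠ 0) (hα : IsPrimitiveRoot α (2 ^ m - 1)) {t : ℕ}
    (h0 : 0 < t) (ht : t < 2 ^ m - 1) : ∑ l : Fin (2 ^ m - 1), α ^ (t * (l : ℕ)) = 0 := by
  rw [sum_pow_primitiveRoot hm hα, if_neg (Nat.not_dvd_of_pos_of_lt h0 ht)]

/-- The roots α^i are distinct, so divisibility by the generator polynomial means vanishing at each
of them. -/
theorem mem_rsCode_iff (hα : IsPrimitiveRoot α (2 ^ m - 1))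
    (c : Fin (2 ^ m - 1) → GaloisField 2 m) :
    c ∈ rsCode m k α ↔ ∀ i < 2 ^ m - 1 - k, ∑ l, c l * α ^ (i * (l : ℕ)) = 0 := by
  have heval : ∀ i : ℕ, Polynomial.eval (α ^ i) (∑ l : Fin (2 ^ m - 1),
      Polynomial.C (c l) * Polynomial.X ^ (l : ℕ)) = ∑ l, c l * α ^ (i * (l : ℕ)) := by
    intro i
    simp [Polynomial.eval_finsetSum, pow_mul]
  constructor
  · intro h i hi
    rw [← heval]
    refine Polynomial.eval_eq_zero_of_dvd_of_eval_eq_zero h ?_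
    rw [Polynomial.eval_prod]
    exact Finset.prod_eq_zero (Finset.mem_range.mpr hi) (by simp)
  · intro h
    refine Finset.prod_dvd_of_coprime ?_ fun i hi => ?_
    · intro i hi j hj hij
      refine Polynomial.isCoprime_X_sub_C_of_isUnit_sub (Ne.isUnit (sub_ne_zero.mpr fun h' => hij ?_))
      rw [Finset.coe_range, Set.mem_Iio] at hi hj
      exact hα.pow_inj (by omega) (by omega) h'
    · rw [Polynomial.dvd_iff_isRoot, Polynomial.IsRoot.def, heval]
      exact h i (Finset.mem_range.mp hi)

/-- The word with components `∑ e < k, f e * α ^ ((e + 1) * l)`. -/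
def rsEval (k : ℕ) (α : GaloisField 2 m) (f : Fin k → GaloisField 2 m)
    (l : Fin (2 ^ m - 1)) : GaloisField 2 m :=
  ∑ e : Fin k, f e * α ^ (((e : ℕ) + 1) * (l : ℕ))

theorem sum_rsEval_mul_pow (f : Fin k → GaloisField 2 m) (i : ℕ) :
    ∑ l, rsEval k α f l * α ^ (i * (l : ℕ)) =
      ∑ e : Fin k, f e * ∑ l : Fin (2 ^ m - 1), α ^ (((e : ℕ) + 1 + i) * (l : ℕ)) := by
  simp only [rsEval, Finset.sum_mul, Finset.mul_sum]
  rw [Finset.sum_comm]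
  refine Finset.sum_congr rfl fun e _ => Finset.sum_congr rfl fun l _ => ?_
  rw [mul_assoc, ← pow_add, add_mul ((e : ℕ) + 1)]

/-- Each exponent e + 1 + i lies strictly between 0 and 2^m - 1, so the power sum vanishes. This is
why the evaluation exponents start at 1. -/
theorem rsEval_mem (hm : m ≠ 0) (hα : IsPrimitiveRoot α (2 ^ m - 1))
    (f : Fin k → GaloisField 2 m) : rsEval k α f ∈ rsCode m k α := by
  rw [mem_rsCode_iff hα]
  intro i hi
  rw [sum_rsEval_mul_pow]
  refine Finset.sum_eq_zero fun e _ => ?_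
  rw [sum_pow_primitiveRoot_eq_zero hm hα (by omega) (by omega), mul_zero]

theorem dvd_add_sub_iff {n a b : ℕ} (ha : a < n) (hb : b < n) : n ∣ a + n - b ↔ a = b := by
  constructor
  · rintro ⟨c, hc⟩
    have h1 : c = 1 := by
      rcases c with _ | _ | c
      · simp at hc; omega
      · rfl
      · have : n * 2 ≤ n * (c + 2) := Nat.mul_le_mul_left _ (by omega)
        rw [show c + 1 + 1 = c + 2 from rfl] at hc
        omega
    subst h1
    omega
  · rintro rfl
    simp

/-- Inversion of the discrete Fourier transform. -/
theorem fourier_inversion (hm : m ≠ 0) (hα : IsPrimitiveRoot α (2 ^ m - 1))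
    (c : Fin (2 ^ m - 1) → GaloisField 2 m) (l : Fin (2 ^ m - 1)) :
    ∑ i ∈ Finset.range (2 ^ m - 1),
      (∑ l', c l' * α ^ (i * (l' : ℕ))) * α ^ ((2 ^ m - 1 - i) * (l : ℕ)) = c l := by
  have h0 : α ≠ 0 := by
    rintro rfl
    have := hα.pow_eq_one
    rw [zero_pow (by have := l.2; omega)] at this
    exact zero_ne_one this
  -- Modulo the order of α, (-i)l is rewritten as (-l)i, so that after exchanging the sums the inner
  -- one is a power sum in i with frequency l' - l.
  have key : ∀ i ∈ Finset.range (2 ^ m - 1), α ^ ((2 ^ m - 1 - i) * (l : ℕ)) =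
      α ^ ((2 ^ m - 1 - (l : ℕ)) * i) := by
    intro i hi
    rw [Finset.mem_range] at hi
    have hl := l.2
    apply mul_right_cancel₀ (pow_ne_zero (i * (l : ℕ)) h0)
    rw [← pow_add, ← pow_add, ← add_mul, Nat.sub_add_cancel hi.le, mul_comm i, ← add_mul,
      Nat.sub_add_cancel hl.le, pow_mul, pow_mul, hα.pow_eq_one, one_pow, one_pow]
  rw [Finset.sum_congr rfl fun i hi => by rw [key i hi, Finset.sum_mul], Finset.sum_comm]
  rw [Finset.sum_eq_single l]
  · have : ∀ i ∈ Finset.range (2 ^ m - 1),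
        c l * α ^ (i * (l : ℕ)) * α ^ ((2 ^ m - 1 - (l : ℕ)) * i) = c l := by
      intro i hi
      rw [mul_assoc, ← pow_add, mul_comm i, ← add_mul, Nat.add_sub_cancel' l.2.le, pow_mul,
        hα.pow_eq_one, one_pow, mul_one]
    rw [Finset.sum_congr rfl this, Finset.sum_const, Finset.card_range, nsmul_eq_mul,
      natCast_two_pow_sub_one hm, one_mul]
  · intro l' _ hl'
    have : ∀ i ∈ Finset.range (2 ^ m - 1),
        c l' * α ^ (i * (l' : ℕ)) * α ^ ((2 ^ m - 1 - (l : ℕ)) * i) =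
          c l' * α ^ (((l' : ℕ) + (2 ^ m - 1) - l) * i) := by
      intro i hi
      rw [mul_assoc, ← pow_add, mul_comm i, ← add_mul, Nat.add_sub_assoc l.2.le]
    rw [Finset.sum_congr rfl this, ← Finset.mul_sum,
      ← Fin.sum_univ_eq_sum_range fun i => α ^ (((l' : ℕ) + (2 ^ m - 1) - l) * i),
      sum_pow_primitiveRoot hm hα, if_neg, mul_zero]
    rw [dvd_add_sub_iff l'.2 l.2]
    exact fun h => hl' (Fin.ext h)
  · simp

theorem exists_eq_rsEval (hm : m ≠ 0) (hα : IsPrimitiveRoot α (2 ^ m - 1)) (hk : k ≤ 2 ^ m - 1)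
    {c : Fin (2 ^ m - 1) → GaloisField 2 m} (hc : c ∈ rsCode m k α) :
    ∃ f, c = rsEval k α f := by
  rw [mem_rsCode_iff hα] at hc
  -- The coefficient of exponent e + 1 is the Fourier coefficient at -(e + 1). Membership in the
  -- code kills all others.
  refine ⟨fun e => ∑ l', c l' * α ^ ((2 ^ m - 1 - 1 - (e : ℕ)) * (l' : ℕ)), funext fun l => ?_⟩
  rw [← fourier_inversion hm hα c l, ← Finset.sum_range_reflect]
  unfold rsEval
  rw [Fin.sum_univ_eq_sum_range fun e => (∑ l', c l' * α ^ ((2 ^ m - 1 - 1 - e) * (l' : ℕ))) *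
    α ^ ((e + 1) * (l : ℕ))]
  symm
  refine (Finset.sum_subset (Finset.range_subset_range.mpr hk) fun j hj hj' => ?_).trans
    (Finset.sum_congr rfl fun j hj => ?_)
  · rw [Finset.mem_range] at hj hj'
    rw [hc _ (by omega), zero_mul]
  · rw [Finset.mem_range] at hj
    rw [show 2 ^ m - 1 - (2 ^ m - 1 - 1 - j) = j + 1 by omega]

/-- Pairing with the power of exponent -(e + 1) recovers the e-th coefficient. -/
theorem rsEval_injective (hm : m ≠ 0) (hα : IsPrimitiveRoot α (2 ^ m - 1)) (hk : k ≤ 2 ^ m - 1) :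
    Function.Injective (rsEval k α) := by
  have key : ∀ f : Fin k → GaloisField 2 m, ∀ e : Fin k,
      ∑ l, rsEval k α f l * α ^ ((2 ^ m - 1 - 1 - (e : ℕ)) * (l : ℕ)) = f e := by
    intro f e
    rw [sum_rsEval_mul_pow, Finset.sum_eq_single e]
    · rw [sum_pow_primitiveRoot hm hα, if_pos, mul_one]
      rw [show (e : ℕ) + 1 + (2 ^ m - 1 - 1 - (e : ℕ)) = 2 ^ m - 1 by have := e.2; omega]
    · intro e' _ he'
      rw [sum_pow_primitiveRoot hm hα, if_neg, mul_zero]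
      have h1 := e.2
      have h2 := e'.2
      rw [show (e' : ℕ) + 1 + (2 ^ m - 1 - 1 - (e : ℕ)) = e' + (2 ^ m - 1) - e by omega,
        dvd_add_sub_iff (by omega) (by omega)]
      exact fun h => he' (Fin.ext h)
    · simp
  intro f g h
  funext e
  rw [← key f e, ← key g e, h]

theorem natCard_rsCode (hm : m ≠ 0) (hα : IsPrimitiveRoot α (2 ^ m - 1)) (hk : k ≤ 2 ^ m - 1) :
    Nat.card (rsCode m k α) = 2 ^ (m * k) := by
  have : Nat.card (Fin k → GaloisField 2 m) = Nat.card (rsCode m k α) := by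
    refine Nat.card_eq_of_bijective (fun f => ⟨rsEval k α f, rsEval_mem hm hα f⟩) ⟨?_, ?_⟩
    · intro f g h
      exact rsEval_injective hm hα hk (Subtype.ext_iff.mp h)
    · rintro ⟨c, hc⟩
      obtain ⟨f, rfl⟩ := exists_eq_rsEval hm hα hk hc
      exact ⟨f, rfl⟩
  rw [← this, Nat.card_fun, GaloisField.card 2 m hm, Nat.card_fin, pow_mul]

/-- The product of two codewords involves only exponents from 2 to 2k < 2^m - 1, whose power sums
vanish. -/
theorem rsCode_self_orthogonal (hm : m ≠ 0) (hα : IsPrimitiveRoot α (2 ^ m - 1))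
    (hk : 2 * k < 2 ^ m - 1) {c d : Fin (2 ^ m - 1) → GaloisField 2 m}
    (hc : c ∈ rsCode m k α) (hd : d ∈ rsCode m k α) : ∑ l, c l * d l = 0 := by
  obtain ⟨f, rfl⟩ := exists_eq_rsEval hm hα (by omega) hc
  obtain ⟨g, rfl⟩ := exists_eq_rsEval hm hα (by omega) hd
  have : ∑ l, rsEval k α f l * rsEval k α g l =
      ∑ e : Fin k, g e * ∑ l, rsEval k α f l * α ^ (((e : ℕ) + 1) * (l : ℕ)) := by
    have hg : ∀ l, rsEval k α g l = ∑ e : Fin k, g e * α ^ (((e : ℕ) + 1) * (l : ℕ)) :=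
      fun _ => rfl
    simp only [hg, Finset.mul_sum]
    rw [Finset.sum_comm]
    exact Finset.sum_congr rfl fun e _ => Finset.sum_congr rfl fun l _ => by ring
  rw [this]
  refine Finset.sum_eq_zero fun e _ => ?_
  rw [sum_rsEval_mul_pow, Finset.sum_eq_zero, mul_zero]
  intro e' _
  rw [sum_pow_primitiveRoot_eq_zero hm hα (by omega) (by have := e.2; have := e'.2; omega), mul_zero]

theorem sum_of_mem_rsCode (hα : IsPrimitiveRoot α (2 ^ m - 1)) (hk : k < 2 ^ m - 1)
    {c : Fin (2 ^ m - 1) → GaloisField 2 m} (hc : c ∈ rsCode m k α) : ∑ l, c l = 0 := by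
  rw [mem_rsCode_iff hα] at hc
  simpa using hc 0 (by omega)

theorem one_notMem_rsCode (hm : m ≠ 0) (hα : IsPrimitiveRoot α (2 ^ m - 1))
    (hk : k < 2 ^ m - 1) : (fun _ => 1) ∉ rsCode m k α := by
  intro h
  have := sum_of_mem_rsCode hα hk h
  simp [natCast_two_pow_sub_one hm] at this

/-- Nonzero words of the dual of a `k`-dimensional Reed-Solomon code have weight greater
than `k`. -/
theorem lt_card_support_of_dual_rsCode [DecidableEq (GaloisField 2 m)] (hm : m ≠ 0)
    (hα : IsPrimitiveRoot α (2 ^ m - 1))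
    {x : Fin (2 ^ m - 1) → GaloisField 2 m} (hx : ∀ c ∈ rsCode m k α, ∑ l, x l * c l = 0)
    (hx0 : x ≠ 0) : k < (Finset.univ.filter fun l => x l ≠ 0).card := by
  classical
  by_contra! hcard
  obtain ⟨l₀, hl₀⟩ := Function.ne_iff.mp hx0
  simp only [Pi.zero_apply] at hl₀
  set T := (Finset.univ.filter fun l => x l ≠ 0) with hT
  have hl₀T : l₀ ∈ T := by simp [hT, hl₀]
  have hα0 : α ≠ 0 := by
    rintro rfl
    have := hα.pow_eq_one
    rw [zero_pow (by have := l₀.2; omega)] at this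
    exact zero_ne_one this
  -- P has degree below k and vanishes at every support point except l₀. Its codeword therefore
  -- meets x only at l₀, where the product is nonzero.
  let P : Polynomial (GaloisField 2 m) :=
    ∏ l ∈ T.erase l₀, (Polynomial.X - Polynomial.C (α ^ (l : ℕ)))
  have hdeg : P.natDegree < k := by
    rw [Polynomial.natDegree_finsetProd_X_sub_C_eq_card, Finset.card_erase_of_mem hl₀T]
    have := Finset.card_pos.mpr ⟨_, hl₀T⟩
    omega
  have hval : ∀ l : Fin (2 ^ m - 1), rsEval k α (fun e => P.coeff e) l =
      α ^ (l : ℕ) * P.eval (α ^ (l : ℕ)) := by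
    intro l
    rw [Polynomial.eval_eq_sum_range' hdeg, Finset.mul_sum]
    unfold rsEval
    rw [Fin.sum_univ_eq_sum_range fun e => P.coeff e * α ^ ((e + 1) * (l : ℕ))]
    exact Finset.sum_congr rfl fun e _ => by ring
  have h := hx _ (rsEval_mem hm hα fun e => P.coeff e)
  rw [Finset.sum_eq_single l₀] at h
  · rw [hval, Polynomial.eval_prod] at h
    refine mul_ne_zero hl₀ (mul_ne_zero (pow_ne_zero _ hα0)
      (Finset.prod_ne_zero_iff.mpr fun l hl => ?_)) h
    rw [Polynomial.eval_sub, Polynomial.eval_X, Polynomial.eval_C, sub_ne_zero]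
    exact fun h' => Finset.ne_of_mem_erase hl (Fin.ext (hα.pow_inj l.2 l₀.2 h'.symm))
  · intro l _ hl
    by_cases hxl : x l = 0
    · rw [hxl, zero_mul]
    · have hlT : l ∈ T.erase l₀ := by simp [hT, hl, hxl]
      rw [hval, Polynomial.eval_prod, Finset.prod_eq_zero hlT (by simp), mul_zero, mul_zero]
  · simp

end ReedSolomon

/-! ### Orthonormal sets over the field with two elements and self-dual bases -/

section OrthonormalBasis

variable {V : Type*} [AddCommGroup V] [Module (ZMod 2) V]

/-- A finite set of vectors is orthonormal for the bilinear form `B`. -/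
def BilinOrthonormal (B : LinearMap.BilinForm (ZMod 2) V) (S : Finset V) : Prop :=
  (∀ x ∈ S, B x x = 1) ∧ ∀ x ∈ S, ∀ y ∈ S, x ≠ y → B x y = 0

theorem BilinOrthonormal.insert [DecidableEq V] {B : LinearMap.BilinForm (ZMod 2) V}
    (hB : ∀ x y, B x y = B y x) {S : Finset V} (hS : BilinOrthonormal B S) {w : V}
    (hw : ∀ x ∈ S, B w x = 0) (hww : B w w = 1) :
    BilinOrthonormal B (insert w S) ∧ (insert w S).card = S.card + 1 := by
  have hwS : w ∉ S := fun h => by simp [hw w h] at hww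
  refine ⟨⟨fun x hx => ?_, fun x hx y hy hxy => ?_⟩, Finset.card_insert_of_notMem hwS⟩
  · rcases Finset.mem_insert.mp hx with rfl | hx
    · exact hww
    · exact hS.1 x hx
  · rcases Finset.mem_insert.mp hx with rfl | hx' <;> rcases Finset.mem_insert.mp hy with rfl | hy'
    · exact absurd rfl hxy
    · exact hw y hy'
    · rw [hB]
      exact hw x hx'
    · exact hS.2 x hx' y hy' hxy

theorem BilinOrthonormal.sum_apply {B : LinearMap.BilinForm (ZMod 2) V} {S : Finset V}
    (hS : BilinOrthonormal B S) (c : V → ZMod 2) {x : V} (hx : x ∈ S) :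
    B (∑ y ∈ S, c y • y) x = c x := by
  rw [map_sum, LinearMap.sum_apply, Finset.sum_eq_single x]
  · simp [hS.1 x hx]
  · intro y hy hyx
    simp [hS.2 y hy x hx hyx]
  · exact fun h => absurd hx h

/-- A nondegenerate symmetric non-alternating form over the field with two elements has a finite
orthonormal set with trivial orthogonal complement. -/
theorem exists_bilinOrthonormal [Finite V] (B : LinearMap.BilinForm (ZMod 2) V)
    (hB : ∀ x y, B x y = B y x) (hnd : ∀ x, (∀ y, B x y = 0) → x = 0) (halt : ∃ v, B v v = 1) :
    ∃ S : Finset V, BilinOrthonormal B S ∧ ∀ w, (∀ x ∈ S, B w x = 0) → w = 0 := by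
  classical
  have := Fintype.ofFinite V
  obtain ⟨v₀, hv₀⟩ := halt
  have hne : ((Finset.univ : Finset (Finset V)).filter (BilinOrthonormal B)).Nonempty :=
    ⟨∅, by simp [BilinOrthonormal]⟩
  obtain ⟨S, hS, hmax⟩ := Finset.exists_max_image _ Finset.card hne
  simp only [Finset.mem_filter, Finset.mem_univ, true_and] at hS hmax
  -- S has maximal size, so the form is alternating on its orthogonal complement.
  have hins : ∀ w, (∀ x ∈ S, B w x = 0) → B w w = 0 := by
    intro w hw
    rcases zmod_two_cases (B w w) with h | h
    · exact h
    · obtain ⟨h1, h2⟩ := hS.insert hB hw h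
      have := hmax _ h1
      omega
  have hSne : S.Nonempty := by
    by_contra h
    rw [Finset.not_nonempty_iff_eq_empty] at h
    have := hins v₀ (by simp [h])
    simp [hv₀] at this
  obtain ⟨v, hv⟩ := hSne
  refine ⟨S, hS, fun e he => ?_⟩
  by_contra he0
  have hf₀ : ∃ f₀, B e f₀ = 1 := by
    by_contra! h
    exact he0 (hnd e fun y => (zmod_two_cases _).resolve_right (h y))
  obtain ⟨f₀, hf₀⟩ := hf₀
  obtain ⟨f, hf, hef⟩ : ∃ f, (∀ x ∈ S, B f x = 0) ∧ B e f = 1 := by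
    refine ⟨f₀ - ∑ y ∈ S, B f₀ y • y, fun x hx => ?_, ?_⟩
    · rw [map_sub, LinearMap.sub_apply, hS.sum_apply (fun y => B f₀ y) hx, sub_self]
    · rw [map_sub, map_sum, Finset.sum_eq_zero, hf₀, sub_zero]
      intro y hy
      simp [he y hy]
  have hee := hins e he
  have hff := hins f hf
  have hfe : B f e = 1 := (hB f e).trans hef
  have hvv := hS.1 v hv
  have hev := he v hv
  have hfv := hf v hv
  have hve : B v e = 0 := (hB v e).trans hev
  have hvf : B v f = 0 := (hB v f).trans hfv
  have h11 : (1 : ZMod 2) + 1 = 0 := by decide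
  have hS' : BilinOrthonormal B (S.erase v) :=
    ⟨fun x hx => hS.1 x (Finset.mem_of_mem_erase hx), fun x hx y hy =>
      hS.2 x (Finset.mem_of_mem_erase hx) y (Finset.mem_of_mem_erase hy)⟩
  have hvx : ∀ x ∈ S.erase v, B v x = 0 := fun x hx =>
    hS.2 v hv x (Finset.mem_of_mem_erase hx) (Finset.ne_of_mem_erase hx).symm
  have hex : ∀ x ∈ S.erase v, B e x = 0 := fun x hx => he x (Finset.mem_of_mem_erase hx)
  have hfx : ∀ x ∈ S.erase v, B f x = 0 := fun x hx => hf x (Finset.mem_of_mem_erase hx)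
  -- With e, f a hyperbolic pair orthogonal to S, the vectors v + e, v + f, v + e + f are
  -- orthonormal. Replacing v by these three contradicts maximality.
  obtain ⟨h1, c1⟩ := hS'.insert hB (w := v + e)
    (fun x hx => by simp [hvx x hx, hex x hx]) (by simp [*])
  obtain ⟨h2, c2⟩ := h1.insert hB (w := v + f) (fun x hx => by
    rcases Finset.mem_insert.mp hx with rfl | hx
    · simp [*]
    · simp [hvx x hx, hfx x hx]) (by simp [*])
  obtain ⟨h3, c3⟩ := h2.insert hB (w := v + e + f) (fun x hx => by
    rcases Finset.mem_insert.mp hx with rfl | hx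
    · simp [*]
    rcases Finset.mem_insert.mp hx with rfl | hx
    · simp [*]
    · simp [hvx x hx, hex x hx, hfx x hx]) (by simp [*])
  have := hmax _ h3
  have := Finset.card_erase_add_one hv
  omega

end OrthonormalBasis

theorem exists_selfDualBasis {m : ℕ} (hm : m ≠ 0) :
    ∃ b : Module.Basis (Fin m) (ZMod 2) (GaloisField 2 m), IsSelfDualBasis b := by
  classical
  have := Fintype.ofFinite (GaloisField 2 m)
  set B := Algebra.traceForm (ZMod 2) (GaloisField 2 m) with hBdef
  have hB : ∀ x y, B x y = B y x := fun x y => by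
    simp only [hBdef, Algebra.traceForm_apply, mul_comm]
  have hnd : ∀ x, (∀ y, B x y = 0) → x = 0 :=
    fun x hx => (traceForm_nondegenerate (ZMod 2) (GaloisField 2 m)).1 x hx
  have halt : ∃ v, B v v = 1 := by
    -- If Tr(x^2) were always 0, the trace would vanish identically because every element is a
    -- square, against nondegeneracy.
    by_contra! h
    refine one_ne_zero (hnd 1 fun y => ?_)
    obtain ⟨x, rfl⟩ : ∃ x, x * x = y := by
      have hb : Function.Bijective (frobenius (GaloisField 2 m) 2) :=
        Finite.injective_iff_bijective.mp (frobenius_inj _ 2)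
      obtain ⟨x, hx⟩ := hb.2 y
      exact ⟨x, by rw [← hx, frobenius_def, sq]⟩
    have := (zmod_two_cases (B x x)).resolve_right (h x)
    simpa [hBdef, Algebra.traceForm_apply] using this
  obtain ⟨S, hS, hS0⟩ := exists_bilinOrthonormal B hB hnd halt
  have hli : LinearIndependent (ZMod 2) (fun x : S => (x : GaloisField 2 m)) := by
    rw [Fintype.linearIndependent_iff]
    intro c hc x
    have h1 := hS.sum_apply (fun y => if h : y ∈ S then c ⟨y, h⟩ else 0) x.2
    rw [← Finset.sum_coe_sort] at h1
    simp only [Finset.coe_mem, dite_true, Subtype.coe_eta] at h1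
    rw [← h1, hc]
    simp
  have hspan : ⊤ ≤ Submodule.span (ZMod 2) (Set.range fun x : S => (x : GaloisField 2 m)) := by
    intro v _
    have h0 := hS0 (v - ∑ y ∈ S, B v y • y) fun x hx => by
      rw [map_sub, LinearMap.sub_apply, hS.sum_apply (fun y => B v y) hx, sub_self]
    rw [sub_eq_zero.mp h0]
    exact Submodule.sum_mem _ fun y hy => Submodule.smul_mem _ _ (Submodule.subset_span ⟨⟨y, hy⟩, rfl⟩)
  let b := Module.Basis.mk hli hspan
  have hcard : Fintype.card S = m := by
    rw [← Module.finrank_eq_card_basis b, GaloisField.finrank 2 hm]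
  let e : S ≃ Fin m := Fintype.equivFinOfCardEq hcard
  refine ⟨b.reindex e, fun i j => ?_⟩
  rw [← Algebra.traceForm_apply, ← hBdef, Module.Basis.reindex_apply, Module.Basis.reindex_apply,
    Module.Basis.mk_apply, Module.Basis.mk_apply]
  split_ifs with h
  · rw [h]
    exact hS.1 _ (e.symm j).2
  · exact hS.2 _ (e.symm i).2 _ (e.symm j).2 fun h' => h (e.symm.injective (Subtype.ext h'))

theorem exists_isPrimitiveRoot_galoisField {m : ℕ} (hm : m ≠ 0) :
    ∃ α : GaloisField 2 m, IsPrimitiveRoot α (2 ^ m - 1) := by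
  obtain ⟨g, hg⟩ := IsCyclic.exists_ofOrder_eq_natCard (α := (GaloisField 2 m)ˣ)
  have h := IsPrimitiveRoot.orderOf g
  rw [hg, Nat.card_units, GaloisField.card 2 m hm] at h
  exact ⟨g, IsPrimitiveRoot.coe_units_iff.mpr h⟩

/-! ### Additive codes from binary codes, binary expansion and quantum Reed–Solomon codes -/

section OmegaCode

variable {ι : Type} [Fintype ι]

theorem traceInner_ofBits (x y x' y' : ι → ZMod 2) :
    traceInner (fun p => ofBits (x p) (y p)) (fun p => ofBits (x' p) (y' p)) =
      algebraMap (ZMod 2) F4 (∑ p, (x p * y' p + y p * x' p)) := by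
  unfold traceInner
  rw [map_sum]
  exact Finset.sum_congr rfl fun p _ => ofBits_pairing _ _ _ _

theorem exists_eq_ofBits {ι : Type} (v : ι → F4) : ∃ x y : ι → ZMod 2, v = fun p => ofBits (x p) (y p) := by
  choose x y h using fun p => exists_ofBits (v p)
  exact ⟨x, y, funext h⟩

theorem ofBits_word_injective {ι : Type} {x y x' y' : ι → ZMod 2}
    (h : (fun p => ofBits (x p) (y p)) = fun p => ofBits (x' p) (y' p)) : x = x' ∧ y = y' := by
  have hp : ∀ p, (x p, y p) = (x' p, y' p) := fun p => ofBits_injective (congrFun h p)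
  exact ⟨funext fun p => (Prod.ext_iff.mp (hp p)).1, funext fun p => (Prod.ext_iff.mp (hp p)).2⟩

theorem ofBits_mem_omegaCode {ι : Type} {B : Submodule (ZMod 2) (ι → ZMod 2)} {x y : ι → ZMod 2} :
    (fun p => ofBits (x p) (y p)) ∈ omegaCode B ↔ x ∈ B ∧ y ∈ B := by
  constructor
  · rintro ⟨x', hx', y', hy', h⟩
    obtain ⟨rfl, rfl⟩ := ofBits_word_injective (x := x) (y := y) (x' := x') (y' := y') h
    exact ⟨hx', hy'⟩
  · rintro ⟨hx, hy⟩
    exact ⟨x, hx, y, hy, rfl⟩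

theorem natCard_omegaCode {ι : Type} (B : Submodule (ZMod 2) (ι → ZMod 2)) :
    Nat.card (omegaCode B) = Nat.card B ^ 2 := by
  rw [sq, ← Nat.card_prod]
  symm
  refine Nat.card_eq_of_bijective (fun p : B × B =>
    ⟨fun i => ofBits (p.1.1 i) (p.2.1 i), ofBits_mem_omegaCode.mpr ⟨p.1.2, p.2.2⟩⟩) ⟨?_, ?_⟩
  · rintro ⟨x, y⟩ ⟨x', y'⟩ h
    obtain ⟨h1, h2⟩ := ofBits_word_injective (Subtype.ext_iff.mp h)
    exact Prod.ext (Subtype.ext h1) (Subtype.ext h2)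
  · rintro ⟨_, x, hx, y, hy, rfl⟩
    exact ⟨⟨⟨x, hx⟩, ⟨y, hy⟩⟩, rfl⟩

/-- The trace form pairs ω-parts only with conjugate parts, so testing against words of one kind
separates the two binary conditions. -/
theorem ofBits_mem_traceDual_omegaCode {B : Submodule (ZMod 2) (ι → ZMod 2)} {x y : ι → ZMod 2} :
    (fun p => ofBits (x p) (y p)) ∈ traceDual (omegaCode B) ↔
      ∀ z ∈ B, ∑ p, x p * z p = 0 ∧ ∑ p, y p * z p = 0 := by
  have hinj := FaithfulSMul.algebraMap_injective (ZMod 2) F4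
  constructor
  · intro h z hz
    have h1 := h (fun p => ofBits ((0 : ι → ZMod 2) p) (z p))
      (ofBits_mem_omegaCode.mpr ⟨B.zero_mem, hz⟩)
    have h2 := h (fun p => ofBits (z p) ((0 : ι → ZMod 2) p))
      (ofBits_mem_omegaCode.mpr ⟨hz, B.zero_mem⟩)
    rw [traceInner_ofBits, map_eq_zero_iff _ hinj] at h1 h2
    simpa using And.intro h1 h2
  · rintro h _ ⟨x', hx', y', hy', rfl⟩
    have := traceInner_ofBits x y x' y'
    refine this.trans ?_
    rw [Finset.sum_add_distrib, (h y' hy').1, (h x' hx').2]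
    simp

end OmegaCode

section BinaryExpansion

variable {m n : ℕ} (b : Module.Basis (Fin m) (ZMod 2) (GaloisField 2 m))

/-- The word over the field with `2 ^ m` elements with the given binary expansion. -/
def fieldWord (x : Fin n × Fin m → ZMod 2) (l : Fin n) : GaloisField 2 m :=
  ∑ j, x (l, j) • b j

theorem fieldWord_bijective : Function.Bijective (fieldWord (n := n) b) := by
  constructor
  · intro x y h
    funext ⟨l, j⟩
    have h1 := congrFun h l
    have h2 := congrArg (fun v => b.repr v j) h1
    simpa [fieldWord, Finsupp.single_apply] using h2
  · intro w
    refine ⟨fun p => b.repr (w p.1) p.2, funext fun l => ?_⟩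
    exact b.sum_repr (w l)

theorem mem_binaryExpansion {C : Submodule (GaloisField 2 m) (Fin n → GaloisField 2 m)}
    {x : Fin n × Fin m → ZMod 2} : x ∈ binaryExpansion b C ↔ fieldWord b x ∈ C := Iff.rfl

theorem natCard_binaryExpansion (C : Submodule (GaloisField 2 m) (Fin n → GaloisField 2 m)) :
    Nat.card (binaryExpansion b C) = Nat.card C := by
  refine Nat.card_eq_of_bijective (fun x => ⟨fieldWord b x.1, x.2⟩) ⟨?_, ?_⟩
  · intro x y h
    exact Subtype.ext ((fieldWord_bijective b).1 (Subtype.ext_iff.mp h))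
  · rintro ⟨w, hw⟩
    obtain ⟨x, rfl⟩ := (fieldWord_bijective b).2 w
    exact ⟨⟨x, hw⟩, rfl⟩

variable {b}

theorem sum_mul_eq_trace (hb : IsSelfDualBasis b) (x y : Fin n × Fin m → ZMod 2) :
    ∑ p, x p * y p =
      Algebra.trace (ZMod 2) (GaloisField 2 m) (∑ l, fieldWord b x l * fieldWord b y l) := by
  rw [Fintype.sum_prod_type, map_sum]
  refine Finset.sum_congr rfl fun l _ => ?_
  unfold fieldWord
  rw [Finset.sum_mul_sum, map_sum]
  refine Finset.sum_congr rfl fun i _ => ?_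
  rw [map_sum, Finset.sum_eq_single i]
  · rw [smul_mul_smul_comm, map_smul, hb]
    simp
  · intro j _ hj
    rw [smul_mul_smul_comm, map_smul, hb, if_neg hj.symm, smul_zero]
  · simp

/-- Applying the binary condition to every scalar multiple of c shows that the trace of every
multiple of the field inner product vanishes. -/
theorem sum_fieldWord_mul_eq_zero (hb : IsSelfDualBasis b)
    {C : Submodule (GaloisField 2 m) (Fin n → GaloisField 2 m)} {x : Fin n × Fin m → ZMod 2}
    (hx : ∀ z ∈ binaryExpansion b C, ∑ p, x p * z p = 0) :
    ∀ c ∈ C, ∑ l, fieldWord b x l * c l = 0 := by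
  intro c hc
  refine (traceForm_nondegenerate (ZMod 2) (GaloisField 2 m)).1 _ fun a => ?_
  obtain ⟨z, hz⟩ := (fieldWord_bijective b).2 (a • c)
  have h := hx z (by rw [mem_binaryExpansion, hz]; exact C.smul_mem a hc)
  rw [sum_mul_eq_trace hb, hz] at h
  rw [Algebra.traceForm_apply, Finset.sum_mul, ← h]
  congr 1
  exact Finset.sum_congr rfl fun l _ => by simp only [Pi.smul_apply, smul_eq_mul]; ring

end BinaryExpansion

/-- Existence of quantum Reed-Solomon codes, with the size of the associated code, the block
distance of its dual, and nontriviality. -/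
theorem exists_isQuantumRS {m k : ℕ} (hk : 1 ≤ k) (hk' : k ≤ 2 ^ (m - 1) - 1) :
    ∃ Q : QuantumCode (Fin (2 ^ m - 1) × Fin m), IsQuantumRS m k Q ∧
      Nat.card Q.code = 2 ^ (2 * (m * k)) ∧
      (∀ v ∈ traceDual Q.code, v ≠ 0 →
        k < Set.ncard {l : Fin (2 ^ m - 1) | (fun a => v (l, a)) ≠ 0}) ∧
      ∃ v ∈ traceDual Q.code, v ∉ Q.code := by
  classical
  have hm : m ≠ 0 := by
    rintro rfl
    simp at hk'
    omega
  have hk2 : 2 * k < 2 ^ m - 1 := by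
    have : 2 ^ m = 2 * 2 ^ (m - 1) := by
      rw [← pow_succ', Nat.sub_add_cancel (by omega)]
    omega
  obtain ⟨b, hb⟩ := exists_selfDualBasis hm
  obtain ⟨α, hα⟩ := exists_isPrimitiveRoot_galoisField hm
  have hself : omegaCode (binaryExpansion b (rsCode m k α)) ≤
      traceDual (omegaCode (binaryExpansion b (rsCode m k α))) := by
    rintro _ ⟨x, hx, y, hy, rfl⟩
    refine ofBits_mem_traceDual_omegaCode.mpr fun z hz => ?_
    have h := fun w (hw : w ∈ binaryExpansion b (rsCode m k α)) =>
      rsCode_self_orthogonal hm hα hk2 ((mem_binaryExpansion b).mp hw)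
        ((mem_binaryExpansion b).mp hz)
    rw [sum_mul_eq_trace hb, sum_mul_eq_trace hb, h x hx, h y hy, map_zero]
    exact ⟨rfl, rfl⟩
  refine ⟨⟨_, hself⟩, ⟨hk, hk', α, b, hα, hb, rfl⟩, ?_, ?_, ?_⟩
  · change Nat.card (omegaCode (binaryExpansion b (rsCode m k α))) = _
    rw [natCard_omegaCode, natCard_binaryExpansion, natCard_rsCode hm hα (by omega), ← pow_mul,
      mul_comm 2]
  · intro v hv hv0
    obtain ⟨x, y, rfl⟩ := exists_eq_ofBits v
    have hxy := ofBits_mem_traceDual_omegaCode.mp hv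
    -- A block of v is nonzero wherever one of its bit components is, so the bound for one nonzero
    -- component z, here x or y, suffices.
    have key : ∀ z : Fin (2 ^ m - 1) × Fin m → ZMod 2, z ≠ 0 →
        (∀ w ∈ binaryExpansion b (rsCode m k α), ∑ p, z p * w p = 0) →
        (∀ l a, z (l, a) ≠ 0 → ofBits (x (l, a)) (y (l, a)) ≠ 0) →
        k < Set.ncard {l : Fin (2 ^ m - 1) | (fun a => ofBits (x (l, a)) (y (l, a))) ≠ 0} := by
      intro z hz0 hz hzv
      have h1 := lt_card_support_of_dual_rsCode hm hα (sum_fieldWord_mul_eq_zero hb hz) fun h =>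
        hz0 ((fieldWord_bijective b).1 (h.trans (by funext l; simp [fieldWord])))
      refine h1.trans_le ?_
      rw [← Set.ncard_coe_finset]
      refine Set.ncard_le_ncard (fun l hl => ?_) (Set.toFinite _)
      simp only [Finset.coe_filter, Finset.mem_univ, true_and, Set.mem_ofPred_eq] at hl ⊢
      intro h
      refine hl (Finset.sum_eq_zero fun a _ => ?_)
      by_cases hza : z (l, a) = 0
      · rw [hza, zero_smul]
      · exact absurd (congrFun h a) (hzv l a hza)
    by_cases hx0 : x = 0
    · by_cases hy0 : y = 0
      · refine absurd ?_ hv0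
        funext p
        simp [hx0, hy0, ofBits]
      · exact key y hy0 (fun w hw => (hxy w hw).2) fun l a h h' => h (ofBits_eq_zero h').2
    · exact key x hx0 (fun w hw => (hxy w hw).1) fun l a h h' => h (ofBits_eq_zero h').1
  -- The all-one word is orthogonal to the code because α^0 is a root of the generator, and lies
  -- outside it because 2^m - 1 is odd.
  · obtain ⟨x, hx⟩ := (fieldWord_bijective (n := 2 ^ m - 1) b).2 fun _ => 1
    refine ⟨fun p => ofBits (x p) ((0 : Fin (2 ^ m - 1) × Fin m → ZMod 2) p),
      ofBits_mem_traceDual_omegaCode.mpr fun z hz => ⟨?_, by simp⟩, fun h => ?_⟩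
    · rw [sum_mul_eq_trace hb, hx]
      have := sum_of_mem_rsCode hα (by omega) ((mem_binaryExpansion b).mp hz)
      simp only [one_mul, this, map_zero]
    · have h1 := (ofBits_mem_omegaCode.mp h).1
      rw [mem_binaryExpansion, hx] at h1
      exact one_notMem_rsCode hm hα (by omega) h1

/-! ### Standard stabilizer codes and the choice of a symplectic map -/

/-- The additive subgroup `{0, ω}` of `F4`. -/
def omegaLine : AddSubgroup F4 where
  carrier := {x | ∃ a, x = ofBits a 0}
  zero_mem' := ⟨0, by simp [ofBits]⟩
  add_mem' := by
    rintro _ _ ⟨a, rfl⟩ ⟨b, rfl⟩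
    exact ⟨a + b, by rw [← ofBits_add, add_zero]⟩
  neg_mem' := by
    rintro _ ⟨a, rfl⟩
    refine ⟨a, ?_⟩
    linear_combination (-ofBits a 0) * F4.two_eq_zero

theorem ofBits_one_zero : ofBits 1 0 = omega := by simp [ofBits]

theorem ofBits_zero_one : ofBits 0 1 = conj omega := by simp [ofBits]

theorem omega_mem_omegaLine : omega ∈ omegaLine := ⟨1, ofBits_one_zero.symm⟩

theorem natCard_omegaLine : Nat.card omegaLine = 2 := by
  have : Nat.card (ZMod 2) = Nat.card omegaLine := by
    refine Nat.card_eq_of_bijective (fun a => ⟨ofBits a 0, a, rfl⟩) ⟨fun a b h => ?_, ?_⟩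
    · have := ofBits_injective (a₁ := (a, 0)) (a₂ := (b, 0)) (Subtype.ext_iff.mp h)
      exact (Prod.ext_iff.mp this).1
    · rintro ⟨_, a, rfl⟩
      exact ⟨a, rfl⟩
  rw [← this, Nat.card_zmod]

theorem pairing_omegaLine {x y : F4} (hx : x ∈ omegaLine) (hy : y ∈ omegaLine) :
    x * conj y + conj x * y = 0 := by
  obtain ⟨a, rfl⟩ := hx
  obtain ⟨b, rfl⟩ := hy
  rw [ofBits_pairing]
  simp

theorem mem_omegaLine_of_pairing {x : F4} (hx : x * conj omega + conj x * omega = 0) :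
    x ∈ omegaLine := by
  obtain ⟨a, b, rfl⟩ := exists_ofBits x
  rw [← ofBits_one_zero, ofBits_pairing] at hx
  simp only [mul_zero, mul_one, zero_add, map_eq_zero] at hx
  exact ⟨a, by rw [hx]⟩

section StandardCode

variable {ι : Type} [DecidableEq ι]

theorem natCard_addSubgroup_pi {ι : Type} [Fintype ι] (H : ι → AddSubgroup F4) :
    Nat.card (AddSubgroup.pi Set.univ H) = ∏ i, Nat.card (H i) := by
  rw [← Nat.card_pi]
  refine Nat.card_congr ⟨fun v i => ⟨v.1 i, v.2 i trivial⟩, fun v => ⟨fun i => v i, fun i _ => (v i).2⟩,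
    fun v => rfl, fun v => rfl⟩

/-- The vectors with components in `{0, ω}`, vanishing on `T`. -/
def standardCode (T : Finset ι) : AddSubgroup (ι → F4) :=
  AddSubgroup.pi Set.univ fun i => if i ∈ T then ⊥ else omegaLine

/-- The vectors with components in `{0, ω}` outside `T`. -/
def standardDual (T : Finset ι) : AddSubgroup (ι → F4) :=
  AddSubgroup.pi Set.univ fun i => if i ∈ T then ⊤ else omegaLine

theorem mem_standardCode {T : Finset ι} {v : ι → F4} :
    v ∈ standardCode T ↔ (∀ i ∈ T, v i = 0) ∧ ∀ i ∉ T, v i ∈ omegaLine := by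
  simp only [standardCode, AddSubgroup.mem_pi, Set.mem_univ, true_imp_iff]
  constructor
  · intro h
    refine ⟨fun i hi => ?_, fun i hi => ?_⟩ <;> have := h i <;> simp [hi] at this <;> exact this
  · rintro ⟨h1, h2⟩ i
    split_ifs with hi
    · exact h1 i hi
    · exact h2 i hi

theorem mem_standardDual {T : Finset ι} {v : ι → F4} :
    v ∈ standardDual T ↔ ∀ i ∉ T, v i ∈ omegaLine := by
  simp only [standardDual, AddSubgroup.mem_pi, Set.mem_univ, true_imp_iff]
  refine forall_congr' fun i => ?_
  split_ifs with hi <;> simp [hi]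

theorem standardCode_le_standardDual (T : Finset ι) : standardCode T ≤ standardDual T :=
  fun _ hv => mem_standardDual.mpr (mem_standardCode.mp hv).2

variable [Fintype ι]

theorem natCard_standardCode (T : Finset ι) :
    Nat.card (standardCode T) = 2 ^ (Fintype.card ι - T.card) := by
  have h : ∀ i, Nat.card (if i ∈ T then (⊥ : AddSubgroup F4) else omegaLine : AddSubgroup F4) =
      if i ∈ T then 1 else 2 := fun i => by
    split_ifs
    · simp
    · exact natCard_omegaLine
  rw [standardCode, natCard_addSubgroup_pi, Finset.prod_congr rfl fun i _ => h i, Finset.prod_ite,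
    Finset.prod_const_one, one_mul, Finset.prod_const, Finset.filter_not,
    Finset.card_sdiff_of_subset (Finset.filter_subset _ _)]
  simp

theorem natCard_standardDual (T : Finset ι) :
    Nat.card (standardDual T) = 2 ^ (Fintype.card ι + T.card) := by
  have h : ∀ i, Nat.card (if i ∈ T then (⊤ : AddSubgroup F4) else omegaLine : AddSubgroup F4) =
      2 * if i ∈ T then 2 else 1 := fun i => by
    split_ifs
    · rw [AddSubgroup.card_top, F4.natCard]
    · exact natCard_omegaLine
  rw [standardDual, natCard_addSubgroup_pi, Finset.prod_congr rfl fun i _ => h i,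
    Finset.prod_mul_distrib, Finset.prod_ite, Finset.prod_const_one, mul_one, Finset.prod_const,
    Finset.prod_const, ← pow_add]
  simp

/-- Duality works coordinatewise: {0, ω} is its own dual and the dual of 0 is the whole field. -/
theorem traceDual_standardCode (T : Finset ι) : traceDual (standardCode T) = standardDual T := by
  ext v
  constructor
  · intro hv
    refine mem_standardDual.mpr fun i hi => mem_omegaLine_of_pairing ?_
    rw [← traceInner_single]
    refine hv _ (mem_standardCode.mpr ⟨fun j hj => ?_, fun j _ => ?_⟩)
    · rw [Pi.single_eq_of_ne]
      rintro rfl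
      exact hi hj
    · rcases eq_or_ne j i with rfl | hji
      · rw [Pi.single_eq_same]
        exact omega_mem_omegaLine
      · rw [Pi.single_eq_of_ne hji]
        exact omegaLine.zero_mem
  · intro hv w hw
    rw [mem_standardDual] at hv
    rw [mem_standardCode] at hw
    refine Finset.sum_eq_zero fun i _ => ?_
    by_cases hi : i ∈ T
    · rw [hw.1 i hi]
      simp [conj]
    · exact pairing_omegaLine (hv i hi) (hw.2 i hi)

/-- A Gilbert-Varshamov argument over the symplectic group, for finitely many codes at once. -/
theorem exists_symplectic_weight_gt {J : Type*} [Fintype J] (T : J → Finset ι) (p : J → ℝ)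
    (hcount : ∑ j, Nat.card (standardDual (T j)) *
      Set.ncard {u : ι → F4 | (weight u : ℝ) ≤ p j * Fintype.card ι} < 4 ^ Fintype.card ι - 1) :
    ∃ S ∈ symplecticGroup ι, ∀ j, ∀ v ∈ standardDual (T j), v ≠ 0 →
      p j * Fintype.card ι < weight (S v) := by
  classical
  have := Fintype.ofFinite F4
  let A : J → Finset (ι → F4) := fun j => {u | u ≠ 0 ∧ (weight u : ℝ) ≤ p j * Fintype.card ι}
  let D : J → Finset (ι → F4) := fun j => {v | v ≠ 0 ∧ v ∈ standardDual (T j)}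
  -- The forbidden events: a nonzero dual vector of some code sent to a nonzero word of low weight.
  let P : Finset ((ι → F4) × (ι → F4)) := Finset.univ.biUnion fun j => D j ×ˢ A j
  have hP : P.card < 4 ^ Fintype.card ι - 1 := by
    refine (Finset.card_biUnion_le.trans (Finset.sum_le_sum fun j _ => ?_)).trans_lt hcount
    rw [Finset.card_product]
    refine Nat.mul_le_mul ?_ ?_
    · rw [Nat.card_eq_fintype_card, Fintype.card_subtype]
      exact Finset.card_le_card fun v hv => by simp only [D, Finset.mem_filter] at hv ⊢; tauto
    · rw [← Set.ncard_coe_finset]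
      exact Set.ncard_le_ncard (fun u hu => by simpa using (Finset.mem_filter.mp hu).2.2)
        (Set.toFinite _)
  obtain ⟨⟨S, hS⟩, h⟩ := exists_forall_smul_ne (G := symplecticGroup ι) P fun q hq => by
    obtain ⟨j, -, hj⟩ := Finset.mem_biUnion.mp hq
    have hq0 : q.1 ≠ 0 := (Finset.mem_filter.mp (Finset.mem_product.mp hj).1).2.1
    refine hP.trans_le ?_
    have h1 : ((Finset.univ : Finset (ι → F4)).erase 0).card = 4 ^ Fintype.card ι - 1 := by
      rw [Finset.card_erase_of_mem (Finset.mem_univ _), Finset.card_univ, Fintype.card_fun,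
        ← Nat.card_eq_fintype_card (α := F4), F4.natCard]
    rw [← h1, ← Set.ncard_coe_finset, Nat.card_coe_set_eq]
    refine Set.ncard_le_ncard (fun u hu => ?_) (Set.toFinite _)
    exact mem_orbit_symplecticGroup hq0 (Finset.ne_of_mem_erase hu)
  refine ⟨S, hS, fun j v hv hv0 => ?_⟩
  by_contra! hw
  have hSv : S v ≠ 0 := by
    intro h0
    apply hv0
    refine eq_zero_of_traceInner fun w => ?_
    rw [← hS.2, h0, traceInner_zero_left]
  refine h (v, S v) (Finset.mem_biUnion.mpr ⟨j, Finset.mem_univ _, Finset.mem_product.mpr ⟨?_, ?_⟩⟩) rfl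
  · exact Finset.mem_filter.mpr ⟨Finset.mem_univ _, hv0, hv⟩
  · exact Finset.mem_filter.mpr ⟨Finset.mem_univ _, hSv, hw⟩

end StandardCode

/-! ### Symplectic images of standard codes and the inner codes -/

section SymplecticMap

variable {ι : Type} [Fintype ι]

/-- A symplectic permutation as an additive equivalence. -/
def symplecticEquiv (S : symplecticGroup ι) : (ι → F4) ≃+ (ι → F4) :=
  { S.1 with map_add' := S.2.1 }

theorem traceInner_symplecticEquiv (S : symplecticGroup ι) (u v : ι → F4) :
    traceInner (symplecticEquiv S u) (symplecticEquiv S v) = traceInner u v := S.2.2 u v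

theorem traceDual_map_symplecticEquiv (S : symplecticGroup ι) (C : AddSubgroup (ι → F4)) :
    traceDual (C.map (symplecticEquiv S).toAddMonoidHom) =
      (traceDual C).map (symplecticEquiv S).toAddMonoidHom := by
  ext v
  obtain ⟨w, rfl⟩ := (symplecticEquiv S).surjective v
  constructor
  · intro hw
    refine ⟨w, fun u hu => ?_, rfl⟩
    rw [← traceInner_symplecticEquiv S]
    exact hw _ ⟨u, hu, rfl⟩
  · rintro ⟨w', hw', h⟩ _ ⟨u, hu, rfl⟩
    have : w' = w := (symplecticEquiv S).injective h
    subst this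
    exact (traceInner_symplecticEquiv S _ _).trans (hw' u hu)

/-- The stabilizer code obtained from a standard code by a symplectic map. -/
def symplecticCode [DecidableEq ι] (S : symplecticGroup ι) (T : Finset ι) : QuantumCode ι where
  code := (standardCode T).map (symplecticEquiv S).toAddMonoidHom
  selfOrthogonal := by
    rw [traceDual_map_symplecticEquiv, traceDual_standardCode]
    exact AddSubgroup.map_mono (standardCode_le_standardDual T)

theorem traceDual_symplecticCode [DecidableEq ι] (S : symplecticGroup ι) (T : Finset ι) :
    traceDual (symplecticCode S T).code =
      (standardDual T).map (symplecticEquiv S).toAddMonoidHom := by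
  rw [symplecticCode, traceDual_map_symplecticEquiv, traceDual_standardCode]

theorem natCard_symplecticCode [DecidableEq ι] (S : symplecticGroup ι) (T : Finset ι) :
    Nat.card (symplecticCode S T).code = 2 ^ (Fintype.card ι - T.card) := by
  rw [← natCard_standardCode]
  exact (Nat.card_congr ((standardCode T).equivMapOfInjective _
    (symplecticEquiv S).injective).toEquiv).symm

end SymplecticMap

section Extension

variable {κ ι : Type}

/-- Extension by zero of a vector along an embedding of the index types. -/
def extendZero (φ : κ ↪ ι) : (κ → F4) →+ (ι → F4) where
  toFun c := Function.extend φ c 0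
  map_zero' := Function.extend_zero _
  map_add' c d := by
    have := Function.extend_add φ c d 0 0
    rwa [add_zero] at this

theorem extendZero_apply (φ : κ ↪ ι) (c : κ → F4) (q : κ) : extendZero φ c (φ q) = c q :=
  φ.injective.extend_apply _ _ _

theorem extendZero_apply_of_notMem (φ : κ ↪ ι) (c : κ → F4) {i : ι} (hi : ∀ q, φ q ≠ i) :
    extendZero φ c i = 0 :=
  Function.extend_apply' _ _ _ fun ⟨q, hq⟩ => hi q hq

theorem traceInner_extendZero [Fintype κ] [Fintype ι] (φ : κ ↪ ι) (c d : κ → F4) :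
    traceInner (extendZero φ c) (extendZero φ d) = traceInner c d := by
  symm
  refine Fintype.sum_of_injective φ φ.injective _ _ (fun i hi => ?_) fun q => ?_
  · have hi' : ∀ q, φ q ≠ i := fun q hq => hi ⟨q, hq⟩
    simp [extendZero_apply_of_notMem φ _ hi', conj]
  · simp only [extendZero_apply]

end Extension

section InnerCodes

variable {s m n : ℕ}

/-- The positions of the first `j` groups of `m` coordinates each. -/
def initialPositions (φ : Fin s × Fin m ↪ Fin n) (j : Fin s) : Finset (Fin n) :=
  (Finset.Iic j ×ˢ Finset.univ).map φ

theorem card_initialPositions (φ : Fin s × Fin m ↪ Fin n) (j : Fin s) :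
    (initialPositions φ j).card = ((j : ℕ) + 1) * m := by
  simp [initialPositions]

theorem mem_initialPositions {φ : Fin s × Fin m ↪ Fin n} {j : Fin s} {i : Fin n} :
    i ∈ initialPositions φ j ↔ ∃ q : Fin s × Fin m, q.1 ≤ j ∧ φ q = i := by
  simp [initialPositions]

theorem extendZero_mem_standardDual (φ : Fin s × Fin m ↪ Fin n) (j : Fin s)
    {c : Fin s × Fin m → F4} (hc : ∀ q : Fin s × Fin m, j < q.1 → c q = 0) :
    extendZero φ c ∈ standardDual (initialPositions φ j) := by
  rw [mem_standardDual]
  intro i hi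
  rw [mem_initialPositions] at hi
  push Not at hi
  by_cases hq : ∃ q, φ q = i
  · obtain ⟨q, rfl⟩ := hq
    rw [extendZero_apply, hc q (not_le.mp fun h => hi q h rfl)]
    exact omegaLine.zero_mem
  · rw [extendZero_apply_of_notMem φ c (not_exists.mp hq)]
    exact omegaLine.zero_mem

theorem traceInner_single_single {κ : Type} [Fintype κ] [DecidableEq κ] (p q : κ)
    (a b a' b' : ZMod 2) :
    traceInner (Pi.single p (ofBits a b)) (Pi.single q (ofBits a' b')) =
      if p = q then algebraMap (ZMod 2) F4 (a * b' + b * a') else 0 := by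
  rw [traceInner_single]
  split_ifs with h
  · subst h
    rw [Pi.single_eq_same, ofBits_pairing]
  · rw [Pi.single_eq_of_ne (Ne.symm h)]
    simp [conj]

/-- A symplectic automorphism of the inner space and quantum Reed-Solomon codes give the data of
a generalized concatenated code. -/
def concatenationOfSymplectic (hs : 2 ≤ s) (φ : Fin s × Fin m ↪ Fin n)
    (S : symplecticGroup (Fin n)) (k : Fin s → ℕ)
    (outer : Fin s → QuantumCode (Fin (2 ^ m - 1) × Fin m))
    (houter : ∀ j, IsQuantumRS m (k j) (outer j)) : Concatenation s m n where
  two_le := hs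
  outer := outer
  k := k
  outer_rs := houter
  inner j := symplecticCode S (initialPositions φ j)
  inner_params j := by
    have h := (card_initialPositions φ j).symm.trans_le (Finset.card_le_univ _)
    rw [QuantumCode.encodedQubits, natCard_symplecticCode, Nat.log_pow (by norm_num),
      card_initialPositions, QuantumCode.length]
    omega
  nested i j hij := by
    refine AddSubgroup.map_mono fun v hv => ?_
    rw [mem_standardCode] at hv ⊢
    refine ⟨fun l hl => hv.1 l ?_, fun l hl => ?_⟩
    · obtain ⟨q, hq, rfl⟩ := mem_initialPositions.mp hl
      exact mem_initialPositions.mpr ⟨q, hq.trans hij, rfl⟩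
    · by_cases h : l ∈ initialPositions φ j
      · rw [hv.1 l h]
        exact omegaLine.zero_mem
      · exact hv.2 l h
  g p := symplecticEquiv S (extendZero φ (Pi.single p omega))
  h p := symplecticEquiv S (extendZero φ (Pi.single p (conj omega)))
  g_mem p := by
    rw [traceDual_symplecticCode]
    exact ⟨_, extendZero_mem_standardDual φ p.1 fun q hq => by
      rw [Pi.single_eq_of_ne]
      rintro rfl
      exact lt_irrefl _ hq, rfl⟩
  h_mem p := by
    rw [traceDual_symplecticCode]
    exact ⟨_, extendZero_mem_standardDual φ p.1 fun q hq => by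
      rw [Pi.single_eq_of_ne]
      rintro rfl
      exact lt_irrefl _ hq, rfl⟩
  g_g p q := by
    rw [traceInner_symplecticEquiv, traceInner_extendZero, ← ofBits_one_zero,
      traceInner_single_single]
    simp
  h_h p q := by
    rw [traceInner_symplecticEquiv, traceInner_extendZero, ← ofBits_zero_one,
      traceInner_single_single]
    simp
  g_h p q := by
    rw [traceInner_symplecticEquiv, traceInner_extendZero, ← ofBits_zero_one, ← ofBits_one_zero,
      traceInner_single_single]
    simp
  ρ := (symplecticEquiv S).toAddMonoidHom.comp (extendZero φ)
  ρ_omega p := rfl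
  ρ_conj p := rfl

/-- The properties of the map `ρ` that give control over the dual of the concatenated code. -/
structure Concatenation.IsSplit (D : Concatenation s m n) : Prop where
  isometry : ∀ c d, traceInner (D.ρ c) (D.ρ d) = traceInner c d
  mem_traceDual : ∀ (j : Fin s) (c : Fin s × Fin m → F4),
    (∀ q : Fin s × Fin m, j < q.1 → c q = 0) → D.ρ c ∈ traceDual (D.inner j).code
  exists_lift : ∀ v ∈ traceDual D.lastInner.code, ∃ c, v - D.ρ c ∈ D.lastInner.code

theorem concatenationOfSymplectic_isSplit (hs : 2 ≤ s) (φ : Fin s × Fin m ↪ Fin n)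
    (S : symplecticGroup (Fin n)) (k : Fin s → ℕ)
    (outer : Fin s → QuantumCode (Fin (2 ^ m - 1) × Fin m))
    (houter : ∀ j, IsQuantumRS m (k j) (outer j)) :
    (concatenationOfSymplectic hs φ S k outer houter).IsSplit where
  isometry c d := (traceInner_symplecticEquiv S _ _).trans (traceInner_extendZero φ c d)
  mem_traceDual j c hc := by
    change _ ∈ traceDual (symplecticCode S (initialPositions φ j)).code
    rw [traceDual_symplecticCode]
    exact ⟨_, extendZero_mem_standardDual φ j hc, rfl⟩
  exists_lift v hv := by
    change v ∈ traceDual (symplecticCode S (initialPositions φ _)).code at hv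
    rw [traceDual_symplecticCode] at hv
    obtain ⟨w, hw, rfl⟩ := hv
    have hw' := mem_standardDual.mp hw
    -- The range of φ is the last set of free positions. Subtracting the entries there leaves a
    -- vector of the standard code.
    refine ⟨fun q => w (φ q), w - extendZero φ (fun q => w (φ q)),
      mem_standardCode.mpr ⟨fun i hi => ?_, fun i hi => ?_⟩, map_sub _ _ _⟩
    · obtain ⟨q, -, rfl⟩ := mem_initialPositions.mp hi
      rw [Pi.sub_apply, extendZero_apply, sub_self]
    · rw [Pi.sub_apply, extendZero_apply_of_notMem, sub_zero]
      · exact hw' i hi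
      · rintro q rfl
        exact hi (mem_initialPositions.mpr ⟨q, Fin.mk_le_mk.mpr (by have := q.1.2; omega), rfl⟩)

end InnerCodes

/-! ### Dual, size and distance of the concatenated code -/

theorem traceInner_prod {κ ι : Type} [Fintype κ] [Fintype ι] (v w : κ × ι → F4) :
    traceInner v w = ∑ l, traceInner (fun i => v (l, i)) fun i => w (l, i) :=
  Fintype.sum_prod_type _

theorem weight_prod {κ ι : Type} [Fintype κ] [Fintype ι] (v : κ × ι → F4) :
    weight v = ∑ l, weight fun i => v (l, i) := by
  classical
  simp only [weight_eq_card, Finset.card_filter]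
  exact Fintype.sum_prod_type _

namespace Concatenation

variable {s m n : ℕ} (D : Concatenation s m n)

/-- The column of index `l` of the matrix with rows `b j`. -/
def column (b : Fin s → (Fin (2 ^ m - 1) × Fin m → F4)) (l : Fin (2 ^ m - 1)) :
    Fin s × Fin m → F4 :=
  fun p => b p.1 (l, p.2)

/-- The word `(ρ(c_1) + u_1, …, ρ(c_{n₁}) + u_{n₁})` for the columns `c_l` of `b`. -/
def word (b : Fin s → (Fin (2 ^ m - 1) × Fin m → F4)) (u : Fin (2 ^ m - 1) → (Fin n → F4)) :
    Fin (2 ^ m - 1) × Fin n → F4 :=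
  fun q => D.ρ (column b q.1) q.2 + u q.1 q.2

theorem mem_code_iff {v : Fin (2 ^ m - 1) × Fin n → F4} :
    v ∈ D.code ↔ ∃ b : Fin s → (Fin (2 ^ m - 1) × Fin m → F4), (∀ j, b j ∈ (D.outer j).code) ∧
      ∃ u : Fin (2 ^ m - 1) → (Fin n → F4), (∀ l, u l ∈ D.lastInner.code) ∧ v = D.word b u := by
  constructor
  · rintro ⟨b, hb, u, hu, h⟩
    exact ⟨b, hb, u, hu, funext fun q => h q.1 q.2⟩
  · rintro ⟨b, hb, u, hu, rfl⟩
    exact ⟨b, hb, u, hu, fun l i => rfl⟩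

theorem word_slice (b : Fin s → (Fin (2 ^ m - 1) × Fin m → F4))
    (u : Fin (2 ^ m - 1) → (Fin n → F4)) (l : Fin (2 ^ m - 1)) :
    (fun i => D.word b u (l, i)) = D.ρ (column b l) + u l := rfl

theorem sum_traceInner_column (b b' : Fin s → (Fin (2 ^ m - 1) × Fin m → F4)) :
    ∑ l, traceInner (column b l) (column b' l) = ∑ j, traceInner (b j) (b' j) := by
  have h1 : ∀ l, traceInner (column b l) (column b' l) =
      ∑ j, traceInner (fun a => b j (l, a)) fun a => b' j (l, a) := fun l => traceInner_prod _ _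
  rw [Finset.sum_congr rfl fun l _ => h1 l, Finset.sum_comm]
  exact Finset.sum_congr rfl fun j _ => (traceInner_prod _ _).symm

variable {D} (hD : D.IsSplit)
include hD

theorem IsSplit.ρ_mem_traceDual_lastInner (c : Fin s × Fin m → F4) :
    D.ρ c ∈ traceDual D.lastInner.code :=
  hD.mem_traceDual _ c fun q hq => absurd (Fin.lt_def.mp hq) (by
    have := q.1.2
    simp only [not_lt]
    omega)

/-- The image of ρ lies in C_s^⊥ and C_s is self-orthogonal, so every term involving u or u'
vanishes. -/
theorem IsSplit.traceInner_lift (c d : Fin s × Fin m → F4) {u u' : Fin n → F4}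
    (hu : u ∈ D.lastInner.code) (hu' : u' ∈ D.lastInner.code) :
    traceInner (D.ρ c + u) (D.ρ d + u') = traceInner c d := by
  rw [traceInner_add_left, traceInner_add_right, traceInner_add_right, hD.isometry,
    hD.ρ_mem_traceDual_lastInner c u' hu', traceInner_comm u,
    hD.ρ_mem_traceDual_lastInner d u hu, D.lastInner.selfOrthogonal hu u' hu']
  simp

/-- The trace form of F_4^(sm) is nondegenerate and is read off from the lifts, so the lift
determines c. -/
theorem IsSplit.lift_injective {c d : Fin s × Fin m → F4} {u u' : Fin n → F4}
    (hu : u ∈ D.lastInner.code) (hu' : u' ∈ D.lastInner.code)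
    (h : D.ρ c + u = D.ρ d + u') : c = d ∧ u = u' := by
  have hcd : c - d = 0 := eq_zero_of_traceInner fun e => by
    have h1 := hD.traceInner_lift (c - d) e (D.lastInner.code.sub_mem hu hu')
      D.lastInner.code.zero_mem
    rw [← h1, map_sub, show D.ρ c - D.ρ d + (u - u') = (D.ρ c + u) - (D.ρ d + u') by abel, h,
      sub_self, traceInner_zero_left]
  have hcd' := sub_eq_zero.mp hcd
  subst hcd'
  exact ⟨rfl, add_left_cancel h⟩

theorem IsSplit.traceInner_word (b b' : Fin s → (Fin (2 ^ m - 1) × Fin m → F4))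
    {u u' : Fin (2 ^ m - 1) → (Fin n → F4)} (hu : ∀ l, u l ∈ D.lastInner.code)
    (hu' : ∀ l, u' l ∈ D.lastInner.code) :
    traceInner (D.word b u) (D.word b' u') = ∑ j, traceInner (b j) (b' j) := by
  rw [traceInner_prod, ← sum_traceInner_column]
  refine Finset.sum_congr rfl fun l _ => ?_
  rw [word_slice, word_slice]
  exact hD.traceInner_lift _ _ (hu l) (hu' l)

theorem IsSplit.word_injective {b b' : Fin s → (Fin (2 ^ m - 1) × Fin m → F4)}
    {u u' : Fin (2 ^ m - 1) → (Fin n → F4)} (hu : ∀ l, u l ∈ D.lastInner.code)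
    (hu' : ∀ l, u' l ∈ D.lastInner.code) (h : D.word b u = D.word b' u') : b = b' ∧ u = u' := by
  have hl : ∀ l, column b l = column b' l ∧ u l = u' l := fun l =>
    hD.lift_injective (hu l) (hu' l) (by
      funext i
      exact congrFun h (l, i))
  exact ⟨funext fun j => funext fun q => congrFun (hl q.1).1 (j, q.2), funext fun l => (hl l).2⟩

theorem IsSplit.code_le_traceDual : D.code ≤ traceDual D.code := by
  intro v hv w hw
  obtain ⟨b, hb, u, hu, rfl⟩ := D.mem_code_iff.mp hv
  obtain ⟨b', hb', u', hu', rfl⟩ := D.mem_code_iff.mp hw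
  rw [hD.traceInner_word b b' hu hu']
  exact Finset.sum_eq_zero fun j _ => (D.outer j).selfOrthogonal (hb j) _ (hb' j)

theorem IsSplit.natCard_code :
    Nat.card D.code = (∏ j, Nat.card (D.outer j).code) *
      Nat.card D.lastInner.code ^ (2 ^ m - 1) := by
  have : Nat.card ((∀ j, (D.outer j).code) × (Fin (2 ^ m - 1) → D.lastInner.code)) =
      Nat.card D.code := by
    refine Nat.card_eq_of_bijective (fun q => ⟨D.word (fun j => q.1 j) fun l => q.2 l,
      D.mem_code_iff.mpr ⟨_, fun j => (q.1 j).2, _, fun l => (q.2 l).2, rfl⟩⟩) ⟨?_, ?_⟩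
    · rintro ⟨b, u⟩ ⟨b', u'⟩ h
      obtain ⟨h1, h2⟩ := hD.word_injective (fun l => (u l).2) (fun l => (u' l).2)
        (Subtype.ext_iff.mp h)
      exact Prod.ext (funext fun j => Subtype.ext (congrFun h1 j))
        (funext fun l => Subtype.ext (congrFun h2 l))
    · rintro ⟨v, hv⟩
      obtain ⟨b, hb, u, hu, rfl⟩ := D.mem_code_iff.mp hv
      exact ⟨⟨fun j => ⟨b j, hb j⟩, fun l => ⟨u l, hu l⟩⟩, rfl⟩
  rw [← this, Nat.card_prod, Nat.card_pi, Nat.card_fun, Nat.card_fin]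

/-- Codewords supported on one block with entries in C_s put every slice of v into C_s^⊥, where ρ
provides columns. Matrices with one nonzero row then put the j-th row into B_j^⊥. -/
theorem IsSplit.exists_of_mem_traceDual {v : Fin (2 ^ m - 1) × Fin n → F4}
    (hv : v ∈ traceDual D.code) :
    ∃ b : Fin s → (Fin (2 ^ m - 1) × Fin m → F4), (∀ j, b j ∈ traceDual (D.outer j).code) ∧
      ∃ u : Fin (2 ^ m - 1) → (Fin n → F4), (∀ l, u l ∈ D.lastInner.code) ∧ v = D.word b u := by
  classical
  have hslice : ∀ l, (fun i => v (l, i)) ∈ traceDual D.lastInner.code := by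
    intro l w hw
    have hu : ∀ l', (Pi.single l w : Fin (2 ^ m - 1) → (Fin n → F4)) l' ∈ D.lastInner.code := by
      intro l'
      rcases eq_or_ne l' l with rfl | h
      · rwa [Pi.single_eq_same]
      · rw [Pi.single_eq_of_ne h]
        exact D.lastInner.code.zero_mem
    have h := hv _ (D.mem_code_iff.mpr ⟨0, fun j => (D.outer j).code.zero_mem, _, hu, rfl⟩)
    have hz : ∀ l', D.ρ (column 0 l') = 0 := fun l' => map_zero D.ρ
    rw [traceInner_prod, Finset.sum_eq_single l] at h
    · simpa only [word, hz, Pi.zero_apply, zero_add, Pi.single_eq_same] using h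
    · intro l' _ hl'
      simp only [word, hz, Pi.zero_apply, zero_add, Pi.single_eq_of_ne hl']
      exact traceInner_zero_right _
    · simp
  choose c hc using fun l => hD.exists_lift _ (hslice l)
  have hvw : v = D.word (fun j q => c q.1 (j, q.2)) fun l => (fun i => v (l, i)) - D.ρ (c l) := by
    have hcol : ∀ l, column (fun j q => c q.1 (j, q.2)) l = c l := fun l => rfl
    funext q
    simp [word, hcol]
  refine ⟨fun j q => c q.1 (j, q.2), ?_, _, hc, hvw⟩
  · intro j w hw
    have hb : ∀ j', (Pi.single j w : Fin s → (Fin (2 ^ m - 1) × Fin m → F4)) j' ∈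
        (D.outer j').code := by
      intro j'
      rcases eq_or_ne j' j with rfl | h
      · rwa [Pi.single_eq_same]
      · rw [Pi.single_eq_of_ne h]
        exact (D.outer j').code.zero_mem
    have h0 : ∀ l, (0 : Fin (2 ^ m - 1) → (Fin n → F4)) l ∈ D.lastInner.code := fun l =>
      D.lastInner.code.zero_mem
    have h := hv _ (D.mem_code_iff.mpr ⟨_, hb, 0, h0, rfl⟩)
    rw [hvw, hD.traceInner_word _ _ hc h0, Finset.sum_eq_single j] at h
    · simpa only [Pi.single_eq_same] using h
    · intro j' _ hj'
      rw [Pi.single_eq_of_ne hj', traceInner_zero_right]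
    · simp

/-- The distance bound for a generalized concatenated code. -/
theorem IsSplit.exists_mul_le_weight {K : Fin s → ℕ} {d : Fin s → ℝ} (hd : ∀ j, 0 ≤ d j)
    (hK : ∀ j, ∀ v ∈ traceDual (D.outer j).code, v ≠ 0 →
      K j < Set.ncard {l : Fin (2 ^ m - 1) | (fun a => v (l, a)) ≠ 0})
    (hw : ∀ j, ∀ v ∈ traceDual (D.inner j).code, v ≠ 0 → d j ≤ weight v)
    {v : Fin (2 ^ m - 1) × Fin n → F4} (hv : v ∈ traceDual D.code) (hv' : v ∉ D.code) :
    ∃ j, K j * d j ≤ weight v := by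
  classical
  obtain ⟨b, hb, u, hu, rfl⟩ := hD.exists_of_mem_traceDual hv
  have hne : (Finset.univ.filter fun j => b j ≠ 0).Nonempty := by
    by_contra h
    rw [Finset.not_nonempty_iff_eq_empty, Finset.filter_eq_empty_iff] at h
    refine hv' (D.mem_code_iff.mpr ⟨b, fun j => ?_, u, hu, rfl⟩)
    rw [not_not.mp (h (Finset.mem_univ j))]
    exact (D.outer j).code.zero_mem
  -- Take the last nonzero row. As no later row contributes, all slices lie in C_j^⊥, and those
  -- where row j is nonzero are nonzero words there.
  obtain ⟨j, hj, hmax⟩ := Finset.exists_max_image _ id hne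
  have hj0 : b j ≠ 0 := (Finset.mem_filter.mp hj).2
  have hlarge : ∀ j', j < j' → b j' = 0 := by
    intro j' hjj'
    by_contra h
    exact absurd (hmax j' (Finset.mem_filter.mpr ⟨Finset.mem_univ _, h⟩)) (not_le.mpr hjj')
  refine ⟨j, ?_⟩
  set T := Finset.univ.filter fun l : Fin (2 ^ m - 1) => (fun a => b j (l, a)) ≠ 0 with hT
  have hcard : K j < T.card := by
    have h := hK j (b j) (hb j) hj0
    rw [← Set.ncard_coe_finset, hT]
    simpa using h
  have hcol : ∀ l, D.ρ (column b l) ∈ traceDual (D.inner j).code := fun l =>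
    hD.mem_traceDual j _ fun q hq => by
      change b q.1 (l, q.2) = 0
      rw [hlarge _ hq]
      rfl
  have hlast : D.lastInner.code ≤ traceDual (D.inner j).code :=
    (D.nested j _ (Fin.mk_le_mk.mpr (by have := j.2; omega))).trans (D.inner j).selfOrthogonal
  have hblock : ∀ l ∈ T, d j ≤ weight fun i => D.word b u (l, i) := by
    intro l hl
    refine hw j _ ((traceDual (D.inner j).code).add_mem (hcol l) (hlast (hu l))) fun h => ?_
    have h0 := hD.lift_injective (c := column b l) (d := 0) (hu l) D.lastInner.code.zero_mem
      (by rw [map_zero, add_zero]; exact h)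
    refine (Finset.mem_filter.mp hl).2 (funext fun a => ?_)
    exact congrFun h0.1 (j, a)
  rw [weight_prod]
  push_cast
  calc (K j : ℝ) * d j ≤ T.card * d j :=
        mul_le_mul_of_nonneg_right (by exact_mod_cast hcard.le) (hd j)
    _ = ∑ l ∈ T, d j := by rw [Finset.sum_const, nsmul_eq_mul]
    _ ≤ ∑ l ∈ T, (weight fun i => D.word b u (l, i) : ℝ) := Finset.sum_le_sum hblock
    _ ≤ _ := Finset.sum_le_sum_of_subset_of_nonneg (Finset.subset_univ _) fun l _ _ =>
        Nat.cast_nonneg _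

/-- This excludes the default value 0 of the minimum distance; a single nonzero row from an outer
code is enough. -/
theorem IsSplit.exists_mem_traceDual_notMem_code (j : Fin s)
    (hj : ∃ v ∈ traceDual (D.outer j).code, v ∉ (D.outer j).code) :
    ∃ v ∈ traceDual D.code, v ∉ D.code := by
  classical
  obtain ⟨x, hx, hx'⟩ := hj
  have h0 : ∀ l, (0 : Fin (2 ^ m - 1) → (Fin n → F4)) l ∈ D.lastInner.code := fun l =>
    D.lastInner.code.zero_mem
  refine ⟨D.word (Pi.single j x) 0, fun w hw => ?_, fun h => ?_⟩
  · obtain ⟨b, hb, u, hu, rfl⟩ := D.mem_code_iff.mp hw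
    rw [hD.traceInner_word _ _ h0 hu, Finset.sum_eq_single j]
    · rw [Pi.single_eq_same]
      exact hx _ (hb j)
    · intro j' _ hj'
      rw [Pi.single_eq_of_ne hj', traceInner_zero_left]
    · simp
  · obtain ⟨b, hb, u, hu, h⟩ := D.mem_code_iff.mp h
    have := (hD.word_injective h0 hu h).1
    refine hx' ?_
    have h1 := hb j
    rwa [← this, Pi.single_eq_same] at h1

end Concatenation

/-! ### Codes of finite length with prescribed parameters -/

/-- Existence of generalized concatenated codes with prescribed distance and dimension, under a
Gilbert-Varshamov condition on the inner codes. -/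
theorem exists_isGeneralizedConcatenated {s m n : ℕ} (hs : 2 ≤ s) (hn : s * m ≤ n) (k : Fin s → ℕ)
    (hk : ∀ j, 1 ≤ k j) (hk' : ∀ j, k j ≤ 2 ^ (m - 1) - 1) (p : Fin s → ℝ) (hp : ∀ j, 0 ≤ p j)
    (hcount : ∑ j : Fin s, 2 ^ (n + ((j : ℕ) + 1) * m) *
      Set.ncard {u : Fin n → F4 | (weight u : ℝ) ≤ p j * n} < 4 ^ n - 1)
    (d : ℝ) (hd : ∀ j, d ≤ k j * (p j * n)) :
    ∃ Q : QuantumCode (Fin (2 ^ m - 1) × Fin n), IsGeneralizedConcatenated s Q ∧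
      d ≤ Q.minDist ∧
      (Q.encodedQubits : ℝ) = m * ∑ j, (((2 ^ m - 1 : ℕ) : ℝ) - 2 * k j) := by
  have hcard : Fintype.card (Fin s × Fin m) ≤ Fintype.card (Fin n) := by simpa using hn
  obtain ⟨φ⟩ := Function.Embedding.nonempty_of_card_le hcard
  obtain ⟨S, hS, hw⟩ := exists_symplectic_weight_gt (initialPositions φ) p (by
    simpa only [natCard_standardDual, card_initialPositions, Fintype.card_fin] using hcount)
  choose outer houter hcardOuter hdist hne using fun j => exists_isQuantumRS (hk j) (hk' j)
  let D := concatenationOfSymplectic hs φ ⟨S, hS⟩ k outer houter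
  have hD : D.IsSplit := concatenationOfSymplectic_isSplit hs φ ⟨S, hS⟩ k outer houter
  refine ⟨⟨D.code, hD.code_le_traceDual⟩, ⟨D, rfl⟩, ?_, ?_⟩
  · obtain ⟨v, hv, hv'⟩ := hD.exists_mem_traceDual_notMem_code ⟨0, by omega⟩ (hne _)
    obtain ⟨u, hu, hu', hwu⟩ := Nat.sInf_mem
      (s := {d | ∃ u ∈ traceDual D.code, u ∉ D.code ∧ weight u = d}) ⟨_, v, hv, hv', rfl⟩
    obtain ⟨j, hj⟩ := hD.exists_mul_le_weight (K := k) (d := fun j => p j * n)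
      (fun j => mul_nonneg (hp j) (Nat.cast_nonneg _)) hdist (fun j v hv hv0 => by
        change v ∈ traceDual (symplecticCode ⟨S, hS⟩ (initialPositions φ j)).code at hv
        rw [traceDual_symplecticCode] at hv
        obtain ⟨w, hw', rfl⟩ := hv
        have := hw j w hw' (by rintro rfl; exact hv0 (map_zero _))
        rw [Fintype.card_fin] at this
        exact this.le) hu hu'
    refine (hd j).trans (hj.trans ?_)
    rw [hwu]
    exact le_rfl
  · have hlast : Nat.card D.lastInner.code = 2 ^ (n - s * m) := by
      refine (natCard_symplecticCode ⟨S, hS⟩ (initialPositions φ _)).trans ?_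
      rw [card_initialPositions, Fintype.card_fin]
      congr 3
      change s - 1 + 1 = s
      omega
    have hlog : Nat.card D.code = 2 ^ (∑ j, 2 * (m * k j) + (n - s * m) * (2 ^ m - 1)) := by
      rw [hD.natCard_code, hlast, pow_add, ← Finset.prod_pow_eq_pow_sum, ← pow_mul]
      congr 1
      exact Finset.prod_congr rfl fun j _ => hcardOuter j
    have hle : ∑ j, 2 * (m * k j) ≤ s * m * (2 ^ m - 1) := by
      have h1 : ∀ j ∈ (Finset.univ : Finset (Fin s)), 2 * (m * k j) ≤ m * (2 ^ m - 1) := by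
        intro j _
        have h2 : 2 * 2 ^ (m - 1) ≤ 2 ^ m ∨ m = 0 := by
          rcases Nat.eq_zero_or_pos m with h | h
          · exact .inr h
          · left
            rw [← pow_succ', Nat.sub_add_cancel h]
        rcases h2 with h2 | h2
        · have h3 := hk' j
          have h4 : 2 * k j ≤ 2 ^ m - 1 := by omega
          calc 2 * (m * k j) = m * (2 * k j) := by ring
            _ ≤ _ := Nat.mul_le_mul_left _ h4
        · simp [h2]
      refine (Finset.sum_le_sum h1).trans ?_
      rw [Finset.sum_const, Finset.card_univ, Fintype.card_fin, smul_eq_mul, mul_assoc]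
    -- The number of encoded qubits is a truncated subtraction; this bound makes it agree with the
    -- real difference.
    have hadd : ∑ j, 2 * (m * k j) + (n - s * m) * (2 ^ m - 1) ≤ (2 ^ m - 1) * n := by
      have : s * m * (2 ^ m - 1) + (n - s * m) * (2 ^ m - 1) = (2 ^ m - 1) * n := by
        rw [← add_mul, Nat.add_sub_cancel' hn, mul_comm]
      omega
    unfold QuantumCode.encodedQubits QuantumCode.length
    rw [hlog, Nat.log_pow (by norm_num), Fintype.card_prod, Fintype.card_fin, Fintype.card_fin,
      Nat.cast_sub hadd]
    push_cast [Nat.cast_sub hn]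
    rw [Finset.sum_sub_distrib, Finset.sum_const, Finset.card_univ, Fintype.card_fin, nsmul_eq_mul,
      ← Finset.mul_sum, ← Finset.mul_sum, ← Finset.mul_sum]
    ring

/-! ### Asymptotic choice of parameters -/

section Asymptotics

theorem tendsto_two_pow_sub_one : Tendsto (fun m : ℕ => ((2 ^ m - 1 : ℕ) : ℝ)) atTop atTop := by
  refine tendsto_natCast_atTop_atTop.comp (tendsto_atTop_mono (fun m => ?_) tendsto_id)
  have := Nat.lt_two_pow_self (n := m)
  simp only [id]
  omega

theorem tendsto_ceil_mul_div {a : ℝ} (ha : 0 ≤ a) {f : ℕ → ℝ} (hf : Tendsto f atTop atTop) :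
    Tendsto (fun m => (⌈a * f m⌉₊ : ℝ) / f m) atTop (𝓝 a) :=
  (tendsto_nat_ceil_mul_div_atTop ha).comp hf

/-- The Gilbert-Varshamov condition holds eventually. -/
theorem eventually_sum_mul_ncard_lt {s : ℕ} {r : ℝ} (hs : 0 < s) (hr0 : 0 < r) (hr1 : r < 1)
    (p : Fin s → ℝ) (hp0 : ∀ j, 0 < p j) (hp1 : ∀ j, p j ≤ 3 / 4)
    (hp : ∀ j : Fin s, entropy 4 (p j) < 1 / 2 * (1 - r * ((j : ℕ) + 1) / s)) :
    ∀ᶠ m : ℕ in atTop, ∑ j : Fin s, 2 ^ (⌈s / r * m⌉₊ + ((j : ℕ) + 1) * m) *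
      Set.ncard {u : Fin ⌈s / r * (m : ℝ)⌉₊ → F4 |
        (weight u : ℝ) ≤ p j * (⌈s / r * (m : ℝ)⌉₊ : ℕ)} < 4 ^ ⌈s / r * (m : ℝ)⌉₊ - 1 := by
  have hs' : (0 : ℝ) < s := by exact_mod_cast hs
  have hsr : (0 : ℝ) < s / r := by positivity
  have hn : Tendsto (fun m : ℕ => ((⌈s / r * (m : ℝ)⌉₊ : ℕ) : ℝ)) atTop atTop :=
    tendsto_atTop_mono (fun m => Nat.le_ceil _)
      (tendsto_natCast_atTop_atTop.const_mul_atTop hsr)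
  have hlim : Tendsto (fun m : ℕ => ∑ j : Fin s, (4 : ℝ) ^
      (((⌈s / r * (m : ℝ)⌉₊ : ℕ) : ℝ) * (entropy 4 (p j) - 1 / 2 * (1 - r * ((j : ℕ) + 1) / s))))
      atTop (𝓝 (∑ j : Fin s, 0)) := by
    refine tendsto_finsetSum _ fun j _ => ?_
    have h1 := hn.atTop_mul_const_of_neg (sub_neg.mpr (hp j))
    exact (tendsto_rpow_atBot_of_base_gt_one 4 (by norm_num)).comp h1
  rw [Finset.sum_const_zero] at hlim
  -- The sum divided by 4^n tends to 0. Below 1/2, together with n ≥ 1, it gives less than 4^n / 2 ≤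
  -- 4^n - 1.
  filter_upwards [hlim.eventually_lt_const (show (0 : ℝ) < 1 / 2 by norm_num),
    hn.eventually_ge_atTop 1] with m hm hm1
  set n : ℕ := ⌈s / r * (m : ℝ)⌉₊ with hndef
  have hmn : (m : ℝ) * s ≤ r * n := by
    have := Nat.le_ceil (s / r * (m : ℝ))
    rw [← hndef, div_mul_eq_mul_div, div_le_iff₀ hr0] at this
    linarith
  -- Since m ≤ rn/s, the dual size 2^(n + jm) is at most 4^(n/2 + nrj/(2s)), with j counted from 1.
  have hterm : ∀ j : Fin s, ((2 ^ (n + ((j : ℕ) + 1) * m) *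
      Set.ncard {u : Fin n → F4 | (weight u : ℝ) ≤ p j * n} : ℕ) : ℝ) ≤
      (4 : ℝ) ^ (n : ℝ) * (4 : ℝ) ^
        ((n : ℝ) * (entropy 4 (p j) - 1 / 2 * (1 - r * ((j : ℕ) + 1) / s))) := by
    intro j
    have h1 := ncard_weight_le (ι := Fin n) (hp0 j) (hp1 j)
    rw [Fintype.card_fin] at h1
    have h2 : ((2 : ℝ) ^ (n + ((j : ℕ) + 1) * m)) ≤
        (4 : ℝ) ^ ((n : ℝ) * (1 / 2 + 1 / 2 * (r * ((j : ℕ) + 1) / s))) := by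
      rw [show (4 : ℝ) = 2 ^ (2 : ℝ) by norm_num, ← Real.rpow_mul (by norm_num),
        ← Real.rpow_natCast]
      refine Real.rpow_le_rpow_of_exponent_le (by norm_num) ?_
      push_cast
      have h3 : ((j : ℕ) + 1 : ℝ) * m ≤ n * (r * ((j : ℕ) + 1) / s) := by
        rw [← mul_div_assoc, le_div_iff₀ hs']
        nlinarith [mul_le_mul_of_nonneg_left hmn (show (0 : ℝ) ≤ (j : ℕ) + 1 by positivity)]
      linarith
    push_cast
    refine (mul_le_mul h2 h1 (Nat.cast_nonneg _) (by positivity)).trans_eq ?_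
    rw [← Real.rpow_add (by norm_num), ← Real.rpow_add (by norm_num)]
    congr 1
    ring
  have h4 : (4 : ℝ) ^ n ≥ 4 := by
    have : 1 ≤ n := by exact_mod_cast hm1
    calc (4 : ℝ) = 4 ^ 1 := by norm_num
      _ ≤ 4 ^ n := pow_le_pow_right₀ (by norm_num) this
  have hreal : ((∑ j : Fin s, 2 ^ (n + ((j : ℕ) + 1) * m) *
      Set.ncard {u : Fin n → F4 | (weight u : ℝ) ≤ p j * n} : ℕ) : ℝ) < ((4 ^ n - 1 : ℕ) : ℝ) := by
    rw [Nat.cast_sum, Nat.cast_sub (Nat.one_le_pow _ _ (by norm_num))]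
    refine (Finset.sum_le_sum fun j _ => hterm j).trans_lt ?_
    rw [← Finset.mul_sum, Real.rpow_natCast]
    push_cast
    nlinarith
  exact_mod_cast hreal

/-- Generalized concatenated codes with relative distance at least `δ / 2` and rate close to the
limit determined by relative inner distances `p j`. -/
theorem exists_code_near_rate {s : ℕ} {r δ : ℝ} (hs : 2 ≤ s) (hr0 : 0 < r) (hr1 : r < 1)
    (hδ : 0 < δ) (p : Fin s → ℝ) (hpδ : ∀ j, δ < p j) (hp1 : ∀ j, p j ≤ 3 / 4)
    (hp : ∀ j : Fin s, entropy 4 (p j) < 1 / 2 * (1 - r * ((j : ℕ) + 1) / s))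
    {ε : ℝ} (hε : 0 < ε) (M : ℕ) :
    ∃ (m n : ℕ) (Q : QuantumCode (Fin (2 ^ m - 1) × Fin n)),
      IsGeneralizedConcatenated s Q ∧ M ≤ Q.length ∧ δ / 2 ≤ Q.relDist ∧
        |Q.rate - (r - r / s * ∑ j, δ / p j)| < ε := by
  have hs0 : 0 < s := by omega
  have hs' : (0 : ℝ) < s := by exact_mod_cast hs0
  have hsr : (0 : ℝ) < s / r := by positivity
  have hp0 : ∀ j, 0 < p j := fun j => hδ.trans (hpδ j)
  -- The inner rate sm/n tends to r, and k_j is the least integer with k_j p_j ≥ δN/2.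
  let n : ℕ → ℕ := fun m => ⌈s / r * (m : ℝ)⌉₊
  let k : ℕ → Fin s → ℕ := fun m j => ⌈δ / (2 * p j) * ((2 ^ m - 1 : ℕ) : ℝ)⌉₊
  have hn_lim : Tendsto (fun m : ℕ => (n m : ℝ) / m) atTop (𝓝 (s / r)) :=
    tendsto_ceil_mul_div hsr.le tendsto_natCast_atTop_atTop
  have hk_lim : ∀ j, Tendsto (fun m : ℕ => (k m j : ℝ) / ((2 ^ m - 1 : ℕ) : ℝ)) atTop
      (𝓝 (δ / (2 * p j))) := fun j =>
    tendsto_ceil_mul_div (by have := hp0 j; positivity) tendsto_two_pow_sub_one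
  have hrate_lim : Tendsto (fun m : ℕ => ((n m : ℝ) / m)⁻¹ *
      ∑ j, (1 - 2 * ((k m j : ℝ) / ((2 ^ m - 1 : ℕ) : ℝ)))) atTop
      (𝓝 ((s / r)⁻¹ * ∑ j, (1 - 2 * (δ / (2 * p j))))) :=
    (hn_lim.inv₀ hsr.ne').mul (tendsto_finsetSum _ fun j _ =>
      tendsto_const_nhds.sub ((hk_lim j).const_mul 2))
  have hval : (s / r)⁻¹ * ∑ j, (1 - 2 * (δ / (2 * p j))) = r - r / s * ∑ j, δ / p j := by
    have h1 : ∀ j, 1 - 2 * (δ / (2 * p j)) = 1 - δ / p j := fun j => by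
      have := (hp0 j).ne'
      field_simp
    rw [Finset.sum_congr rfl fun j _ => h1 j, Finset.sum_sub_distrib]
    simp only [Finset.sum_const, Finset.card_univ, Fintype.card_fin, nsmul_eq_mul, mul_one]
    field_simp
  rw [hval] at hrate_lim
  have hk_lt : ∀ᶠ m : ℕ in atTop, ∀ j, (k m j : ℝ) / ((2 ^ m - 1 : ℕ) : ℝ) < 1 / 2 := by
    rw [eventually_all]
    intro j
    refine (hk_lim j).eventually_lt_const ?_
    rw [div_lt_iff₀ (by have := hp0 j; positivity)]
    linarith [hpδ j]
  have hclose := hrate_lim.eventually (Metric.ball_mem_nhds _ hε)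
  obtain ⟨m, hcount, hklt, hrate, hmM, hN⟩ :=
    ((eventually_sum_mul_ncard_lt hs0 hr0 hr1 p hp0 hp1 hp).and (hk_lt.and (hclose.and
      ((eventually_ge_atTop (max M 1)).and
        (tendsto_two_pow_sub_one.eventually_ge_atTop 1))))).exists
  have hm1 : 1 ≤ m := (le_max_right _ _).trans hmM
  have hm0 : (0 : ℝ) < m := by exact_mod_cast hm1
  have hN0 : (0 : ℝ) < ((2 ^ m - 1 : ℕ) : ℝ) := by linarith
  have hNn : 1 ≤ 2 ^ m - 1 := by exact_mod_cast hN
  have hsmn : (s : ℝ) * m ≤ n m := by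
    refine le_trans ?_ (Nat.le_ceil _)
    refine mul_le_mul_of_nonneg_right ?_ hm0.le
    rw [le_div_iff₀ hr0]
    nlinarith
  have hsmn' : s * m ≤ n m := by exact_mod_cast hsmn
  have hmn : m ≤ n m := (Nat.le_mul_of_pos_left m hs0).trans hsmn'
  have hn0 : (0 : ℝ) < n m := lt_of_lt_of_le hm0 (by exact_mod_cast hmn)
  have hk2 : ∀ j, 2 * k m j < 2 ^ m - 1 := by
    intro j
    have := hklt j
    rw [div_lt_iff₀ hN0] at this
    have h2 : 2 * (k m j : ℝ) < ((2 ^ m - 1 : ℕ) : ℝ) := by linarith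
    exact_mod_cast h2
  have hpow : 2 * 2 ^ (m - 1) = 2 ^ m := by rw [← pow_succ', Nat.sub_add_cancel hm1]
  have hd : ∀ j, δ / 2 * (((2 ^ m - 1 : ℕ) : ℝ) * n m) ≤ k m j * (p j * n m) := by
    intro j
    have h1 : δ / (2 * p j) * ((2 ^ m - 1 : ℕ) : ℝ) ≤ k m j := Nat.le_ceil _
    calc δ / 2 * (((2 ^ m - 1 : ℕ) : ℝ) * n m) =
        δ / (2 * p j) * ((2 ^ m - 1 : ℕ) : ℝ) * (p j * n m) := by
          have := (hp0 j).ne'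
          field_simp
      _ ≤ _ := mul_le_mul_of_nonneg_right h1 (mul_nonneg (hp0 j).le hn0.le)
  obtain ⟨Q, hQ, hdist, hdim⟩ := exists_isGeneralizedConcatenated hs hsmn' (k m)
    (fun j => Nat.one_le_ceil_iff.mpr (by have := hp0 j; positivity))
    (fun j => by have := hk2 j; omega) p (fun j => (hp0 j).le) hcount _ hd
  have hlen : (Q.length : ℝ) = ((2 ^ m - 1 : ℕ) : ℝ) * n m := by
    unfold QuantumCode.length
    rw [Fintype.card_prod, Fintype.card_fin, Fintype.card_fin, Nat.cast_mul]
  refine ⟨m, n m, Q, hQ, ?_, ?_, ?_⟩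
  · unfold QuantumCode.length
    rw [Fintype.card_prod, Fintype.card_fin, Fintype.card_fin]
    calc M ≤ m := (le_max_left _ _).trans hmM
      _ ≤ n m := hmn
      _ ≤ (2 ^ m - 1) * n m := Nat.le_mul_of_pos_left _ hNn
  · unfold QuantumCode.relDist
    rwa [hlen, le_div_iff₀ (by positivity)]
  · have hr : Q.rate = ((n m : ℝ) / m)⁻¹ *
        ∑ j, (1 - 2 * ((k m j : ℝ) / ((2 ^ m - 1 : ℕ) : ℝ))) := by
      have h1 : ∀ j, 1 - 2 * ((k m j : ℝ) / ((2 ^ m - 1 : ℕ) : ℝ)) =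
          (((2 ^ m - 1 : ℕ) : ℝ) - 2 * k m j) * (((2 ^ m - 1 : ℕ) : ℝ))⁻¹ := fun j => by
        field_simp
      unfold QuantumCode.rate
      rw [hlen, hdim, Finset.sum_congr rfl fun j _ => h1 j, ← Finset.sum_mul]
      field_simp
    rw [hr]
    exact hrate

end Asymptotics

/-! ### Passage to the limiting rate -/

theorem sum_Icc_eq_sum_fin (s : ℕ) (f : ℕ → ℝ) :
    ∑ j ∈ Finset.Icc 1 s, f j = ∑ j : Fin s, f ((j : ℕ) + 1) := by
  rw [Fin.sum_univ_eq_sum_range fun j => f (j + 1), ← Finset.Ico_add_one_right_eq_Icc,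
    Finset.sum_Ico_eq_sum_range]
  simp [add_comm]

end GCQ

end

open GCQ in
theorem theorem4 (r : ℝ) (hr0 : 0 < r) (hr1 : r < 1) (s : ℕ) (hs : 2 ≤ s)
    (δ : ℝ) (hδ0 : 0 < δ) (hδ : δ < entropyInv 4 ((1 - r) / 2)) :
    ∃ (m n₂ : ℕ → ℕ) (Q : ∀ t : ℕ, QuantumCode (Fin (2 ^ m t - 1) × Fin (n₂ t))),
      (∀ t, IsGeneralizedConcatenated s (Q t)) ∧
      AsymptoticallyGood Q ∧
      (∀ t, δ / 2 ≤ (Q t).relDist) ∧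
      Tendsto (fun t => (Q t).rate) atTop
        (𝓝 (r - r / s * ∑ j ∈ Finset.Icc 1 s,
          δ / entropyInv 4 (1 / 2 * (1 - r * j / s)))) := by
  have hs' : (0 : ℝ) < s := by exact_mod_cast (show 0 < s by omega)
  rw [sum_Icc_eq_sum_fin s fun j => δ / entropyInv 4 (1 / 2 * (1 - r * j / s))]
  set y : Fin s → ℝ := fun j => 1 / 2 * (1 - r * ((j : ℕ) + 1) / s) with hy
  have hsum : ∑ j : Fin s, δ / entropyInv 4 (1 / 2 * (1 - r * (((j : ℕ) + 1 : ℕ) : ℝ) / s)) =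
      ∑ j, δ / entropyInv 4 (y j) := by
    simp only [hy, Nat.cast_add, Nat.cast_one]
  rw [hsum]
  have hfrac : ∀ j : Fin s, 0 ≤ r * ((j : ℕ) + 1) / s ∧ r * ((j : ℕ) + 1) / s ≤ r := by
    intro j
    refine ⟨by positivity, ?_⟩
    rw [div_le_iff₀ hs']
    have : ((j : ℕ) + 1 : ℝ) ≤ s := by exact_mod_cast j.2
    exact mul_le_mul_of_nonneg_left this hr0.le
  have hy0 : ∀ j, 0 ≤ y j := fun j => by have := hfrac j; simp only [hy]; linarith
  have hy1 : ∀ j, y j ≤ 1 := fun j => by have := hfrac j; simp only [hy]; linarith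
  -- The smallest y_j is (1 - r)/2, attained at the last index, so monotonicity of the inverse
  -- entropy reduces to the assumption on δ.
  have hδy : ∀ j, δ < entropyInv 4 (y j) := by
    intro j
    refine hδ.trans_le (entropyInv_four_strictMonoOn.monotoneOn ⟨by linarith, by linarith⟩
      ⟨hy0 j, hy1 j⟩ ?_)
    have := hfrac j
    simp only [hy]
    linarith
  set R : ℝ := r - r / s * ∑ j, δ / entropyInv 4 (y j) with hR
  have hRpos : 0 < R := by
    have h1 : ∑ j, δ / entropyInv 4 (y j) < ∑ j : Fin s, (1 : ℝ) := by
      refine Finset.sum_lt_sum_of_nonempty ⟨⟨0, by omega⟩, Finset.mem_univ _⟩ fun j _ => ?_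
      rw [div_lt_one (hδ0.trans (hδy j))]
      exact hδy j
    rw [Finset.sum_const, Finset.card_univ, Fintype.card_fin, nsmul_eq_mul, mul_one] at h1
    have h2 := mul_lt_mul_of_pos_left h1 (div_pos hr0 hs')
    rw [div_mul_cancel₀ _ hs'.ne'] at h2
    linarith
  have hmain : ∀ t : ℕ, ∃ (m n : ℕ) (Q : QuantumCode (Fin (2 ^ m - 1) × Fin n)),
      IsGeneralizedConcatenated s Q ∧ t ≤ Q.length ∧ δ / 2 ≤ Q.relDist ∧
        |Q.rate - R| < 1 / ((t : ℝ) + 1) := by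
    intro t
    have hε : (0 : ℝ) < 1 / ((t : ℝ) + 1) / 2 := by positivity
    -- The Gilbert–Varshamov condition is strict, so each inner distance backs off by η > 0;
    -- continuity keeps the loss of rate below half of the allowed error.
    have hcont : Tendsto (fun η : ℝ => r - r / s * ∑ j, δ / (entropyInv 4 (y j) - η)) (𝓝[>] 0)
        (𝓝 (r - r / s * ∑ j, δ / (entropyInv 4 (y j) - 0))) := by
      refine tendsto_nhdsWithin_of_tendsto_nhds (tendsto_const_nhds.sub (Tendsto.const_mul _
        (tendsto_finsetSum _ fun j _ => ?_)))
      refine tendsto_const_nhds.div (tendsto_const_nhds.sub tendsto_id) ?_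
      rw [sub_zero]
      exact (hδ0.trans (hδy j)).ne'
    simp only [sub_zero] at hcont
    have hsmall : ∀ᶠ η : ℝ in 𝓝[>] 0, ∀ j, η < entropyInv 4 (y j) - δ := by
      rw [eventually_all]
      exact fun j => nhdsWithin_le_nhds (eventually_lt_nhds (sub_pos.mpr (hδy j)))
    obtain ⟨η, hη1, hη2, hη3⟩ := ((hcont.eventually (Metric.ball_mem_nhds _ hε)).and
      (hsmall.and eventually_mem_nhdsWithin)).exists
    have hη0 : 0 < η := hη3
    have hpδ : ∀ j, δ < entropyInv 4 (y j) - η := fun j => by linarith [hη2 j]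
    obtain ⟨m, n, Q, hQ, hlen, hdist, hrate⟩ := exists_code_near_rate hs hr0 hr1 hδ0
      (fun j => entropyInv 4 (y j) - η) hpδ (fun j => by
        have := (entropyInv_four_spec (hy0 j) (hy1 j)).1.2
        norm_num at this
        linarith) (fun j => entropy_lt_of_lt_entropyInv (hy0 j) (hy1 j)
          (hδ0.trans (hpδ j)).le (by linarith)) hε t
    refine ⟨m, n, Q, hQ, hlen, hdist, ?_⟩
    have h1 : |r - r / s * ∑ j, δ / (entropyInv 4 (y j) - η) - R| < 1 / ((t : ℝ) + 1) / 2 := hη1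
    calc |Q.rate - R| ≤ _ := abs_sub_le _ (r - r / s * ∑ j, δ / (entropyInv 4 (y j) - η)) _
      _ < 1 / ((t : ℝ) + 1) := by linarith
  choose m n Q hQ hlen hdist hrate using hmain
  have hlim : Tendsto (fun t => (Q t).rate) atTop (𝓝 R) := by
    rw [tendsto_iff_dist_tendsto_zero]
    exact squeeze_zero (fun t => dist_nonneg) (fun t => (hrate t).le)
      tendsto_one_div_add_atTop_nhds_zero_nat
  refine ⟨m, n, Q, hQ, ⟨tendsto_atTop_mono hlen tendsto_id, min (R / 2) (δ / 2), ?_, ?_⟩, hdist,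
    hlim⟩
  · exact lt_min (by linarith) (by linarith)
  · filter_upwards [hlim.eventually_const_le (show R / 2 < R by linarith)] with t ht
    exact ⟨(min_le_left _ _).trans ht, (min_le_right _ _).trans (hdist t)⟩
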